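/- Let $M$ be $\mathbb S^3$ with the round metric of curvature $K=1$, $\mathbb R^3$ with the flat metric ($K=0$), or $\mathbb H^3$ with the metric of curvature $K=-1$. Let $I\subset\mathbb R$ be an interval with non-empty interior and $\gamma\colon I\to M$ a smooth curve parametrized by arclength. Call $\gamma$ a \emph{proper $\tfrac12$-biharmonic curve} if $\nabla_{\gamma'}\gamma'$ has no zeros on $I$, its geodesic curvature $k=|\nabla_{\gamma'}\gamma'|$ is not constant, and $\gamma$ is a critical point of $$E_{2,1/2}(\gamma)=2\int_I|\nabla_{\gamma'}\gamma'|^{1/2}\,ds$$ with respect to all smooth variations that leave $\gamma$ unchanged outside a compact interval contained in the interior of $I$. Every proper $\tfrac12$-biharmonic curve has a smooth Frenet frame $T=\gamma',N,B$, that is, an orthonormal frame along $\gamma$ with $$\nabla_{\gamma'}T=kN,\qquad \nabla_{\gamma'}N=-kT+\tau B,\qquad \nabla_{\gamma'}B=-\tau N,\qquad k>0 .$$ Moreover, if $\gamma$ has a smooth Frenet frame with geodesic curvature $k>0$ and torsion $\tau$, then: 1. If $M=\mathbb S^3$, then $\gamma$ is proper $\tfrac12$-biharmonic if and only if there are $b_1,b_2,b_3\in\mathbb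 R$ with $b_2^2>4+4b_1^2$ such that on $I$ $$k(s)=\frac{2}{b_2+\sqrt{b_2^2-4-4b_1^2}\,\sin 2(s+b_3)},\qquad \tau(s)=b_1k(s).$$ 2. If $M=\mathbb R^3$, then $\gamma$ is proper $\tfrac12$-biharmonic if and only if there are $b_1,b_4,b_5\in\mathbb R$ such that on $I$ $$k(s)=\frac{b_4}{b_4^2(s-b_5)^2+1+b_1^2},\qquad \tau(s)=b_1k(s).$$ 3. If $M=\mathbb H^3$, then $\gamma$ is proper $\tfrac12$-biharmonic if and only if there are $b_1,b_6,b_7\in\mathbb R$ such that on $I$ $$k(s)=\frac{4e^{-2(b_7+s)}}{\left(b_6+e^{-2(b_7+s)}\right)^2+4+4b_1^2},\qquad \tau(s)=b_1k(s).$$ -/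

import Mathlib

open scoped ContDiff

noncomputable section

/-- A simply connected space form presented inside a real vector space `V`: an ambient symmetric
bilinear form `form`, the sectional curvature `curv`, and the underlying set `carrier`. Only the three
instances `sphere3`, `euclidean3`, `hyperbolic3` below are used. -/
structure SpaceFormModel (V : Type*) [NormedAddCommGroup V] [NormedSpace ℝ V] where
  form : V →ₗ[ℝ] V →ₗ[ℝ] ℝ
  curv : ℝ
  carrier : Set V

/-- The Lorentz form `-x₀y₀ + x₁y₁ + x₂y₂ + x₃y₃` on `ℝ⁴`. -/
def lorentzForm : EuclideanSpace ℝ (Fin 4) →ₗ[ℝ] EuclideanSpace ℝ (Fin 4) →ₗ[ℝ] ℝ :=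
  LinearMap.mk₂ ℝ (fun x y => -(x 0 * y 0) + x 1 * y 1 + x 2 * y 2 + x 3 * y 3)
    (by intro x x' y; simp only [PiLp.add_apply]; ring)
    (by intro c x y; simp only [PiLp.smul_apply, smul_eq_mul]; ring)
    (by intro x y y'; simp only [PiLp.add_apply]; ring)
    (by intro c x y; simp only [PiLp.smul_apply, smul_eq_mul]; ring)

/-- The round unit sphere `S³ ⊂ ℝ⁴`, of curvature `1`. -/
def sphere3 : SpaceFormModel (EuclideanSpace ℝ (Fin 4)) where
  form := innerₗ (EuclideanSpace ℝ (Fin 4))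
  curv := 1
  carrier := Metric.sphere 0 1

/-- Flat Euclidean space `ℝ³`, of curvature `0`. -/
def euclidean3 : SpaceFormModel (EuclideanSpace ℝ (Fin 3)) where
  form := innerₗ (EuclideanSpace ℝ (Fin 3))
  curv := 0
  carrier := Set.univ

/-- Hyperbolic space `H³`, of curvature `-1`, as the upper sheet of the hyperboloid
`⟨x, x⟩ = -1` in Minkowski space, with the Riemannian metric induced by the Lorentz form. -/
def hyperbolic3 : SpaceFormModel (EuclideanSpace ℝ (Fin 4)) where
  form := lorentzForm
  curv := -1
  carrier := {x | lorentzForm x x = -1 ∧ 0 < x 0}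

namespace SpaceFormModel

variable {V : Type*} [NormedAddCommGroup V] [NormedSpace ℝ V]

/-- Orthogonal projection of the ambient space onto the tangent space at `x`. For `K = ±1` the point
`x` satisfies `⟨x, x⟩ = K` and the tangent space is `{v | ⟨v, x⟩ = 0}`; for `K = 0` the
tangent space is the whole ambient space. -/
def tangentProj (M : SpaceFormModel V) (x v : V) : V :=
  v - (M.curv * M.form v x) • x

/-- Riemannian length of a tangent vector. -/
def len (M : SpaceFormModel V) (v : V) : ℝ := Real.sqrt (M.form v v)

/-- Covariant derivative `∇_{γ'} X`, for the Levi-Civita connection, of a vector field `X` along a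
curve `γ` defined on `I`: the tangential part of the ambient derivative. -/
def covDeriv (M : SpaceFormModel V) (I : Set ℝ) (γ X : ℝ → V) (s : ℝ) : V :=
  M.tangentProj (γ s) (derivWithin X I s)

/-- Tension field `τ(γ) = ∇_{γ'} γ'`. -/
def tension (M : SpaceFormModel V) (I : Set ℝ) (γ : ℝ → V) : ℝ → V :=
  M.covDeriv I γ (derivWithin γ I)

/-- `(1/p) ∫_a^b |∇_{γ'} γ'|^p ds`. -/
def pBienergy (M : SpaceFormModel V) (p : ℝ) (I : Set ℝ) (a b : ℝ) (γ : ℝ → V) : ℝ :=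
  (1 / p) * ∫ s in a..b, (M.len (M.tension I γ s)) ^ p

/-- A smooth curve `γ : I → M` parametrized by arclength. -/
structure IsUnitSpeedCurve (M : SpaceFormModel V) (I : Set ℝ) (γ : ℝ → V) : Prop where
  smooth : ContDiffOn ℝ ∞ γ I
  mem : ∀ s ∈ I, γ s ∈ M.carrier
  unit_speed : ∀ s ∈ I, M.form (derivWithin γ I s) (derivWithin γ I s) = 1

/-- A smooth variation `Γ : (-ε, ε) × I → M` of `γ` which leaves `γ` unchanged outside the compact
interval `[a, b]` contained in the interior of `I`. -/
structure IsVariation (M : SpaceFormModel V) (I : Set ℝ) (γ : ℝ → V) (a b ε : ℝ)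
    (Γ : ℝ → ℝ → V) : Prop where
  eps_pos : 0 < ε
  lt : a < b
  subset : Set.Icc a b ⊆ interior I
  smooth : ContDiffOn ℝ ∞ (fun q : ℝ × ℝ => Γ q.1 q.2) (Set.Ioo (-ε) ε ×ˢ I)
  mem : ∀ t ∈ Set.Ioo (-ε) ε, ∀ s ∈ I, Γ t s ∈ M.carrier
  initial : ∀ s ∈ I, Γ 0 s = γ s
  fixed : ∀ t ∈ Set.Ioo (-ε) ε, ∀ s ∈ I \ Set.Icc a b, Γ t s = γ s

/-- `γ` is a critical point of the `p`-bienergy with respect to all smooth compactly supported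
variations. -/
def IsPBiharmonic (M : SpaceFormModel V) (p : ℝ) (I : Set ℝ) (γ : ℝ → V) : Prop :=
  ∀ (a b ε : ℝ) (Γ : ℝ → ℝ → V), M.IsVariation I γ a b ε Γ →
    HasDerivAt (fun t => M.pBienergy p I a b (Γ t)) 0 0

/-- A proper `1/2`-biharmonic curve (parametrized by arclength): a `1/2`-biharmonic curve whose
geodesic curvature `|∇_{γ'} γ'|` is not constant. The Euler-Lagrange operator contains the factor
`|∇_{γ'} γ'|^(-3/2)`, so the tension field is required to have no zeros. -/
structure IsProperHalfBiharmonic (M : SpaceFormModel V) (I : Set ℝ) (γ : ℝ → V) : Prop where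
  tension_ne_zero : ∀ s ∈ I, M.tension I γ s ≠ 0
  biharmonic : M.IsPBiharmonic (1 / 2) I γ
  nonconstant : ∃ s ∈ I, ∃ t ∈ I, M.len (M.tension I γ s) ≠ M.len (M.tension I γ t)

/-- `T = γ'`, `N`, `B` is a smooth Frenet frame along the unit speed curve `γ`, with geodesic
curvature `k > 0` and torsion `τ`. -/
structure IsFrenetFrame (M : SpaceFormModel V) (I : Set ℝ) (γ : ℝ → V) (k τ : ℝ → ℝ)
    (N B : ℝ → V) : Prop where
  smooth_N : ContDiffOn ℝ ∞ N I
  smooth_B : ContDiffOn ℝ ∞ B I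
  tangent_N : ∀ s ∈ I, M.tangentProj (γ s) (N s) = N s
  tangent_B : ∀ s ∈ I, M.tangentProj (γ s) (B s) = B s
  unit_N : ∀ s ∈ I, M.form (N s) (N s) = 1
  unit_B : ∀ s ∈ I, M.form (B s) (B s) = 1
  orth_TN : ∀ s ∈ I, M.form (derivWithin γ I s) (N s) = 0
  orth_TB : ∀ s ∈ I, M.form (derivWithin γ I s) (B s) = 0
  orth_NB : ∀ s ∈ I, M.form (N s) (B s) = 0
  k_pos : ∀ s ∈ I, 0 < k s
  cov_T : ∀ s ∈ I, M.covDeriv I γ (derivWithin γ I) s = k s • N s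
  cov_N : ∀ s ∈ I, M.covDeriv I γ N s = -(k s) • derivWithin γ I s + τ s • B s
  cov_B : ∀ s ∈ I, M.covDeriv I γ B s = -(τ s) • N s

end SpaceFormModel

end

/-! The three geometries are handled at once, inside a vector space with a symmetric form such that
K⟨x,x⟩ = K² on the carrier. A curve lying in the carrier satisfies K(⟨γ,γ''⟩ + ⟨γ',γ'⟩) = 0, so the
squared length of its tension field is ⟨γ'',γ''⟩ - K⟨γ',γ'⟩² (`form_tangentProj_self`). The energy
thus becomes an integral of ambient derivatives, without a connection, and can be differentiated
under the integral sign.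

At a Frenet curve put f = k^(-1/2). Integration by parts (`hasDerivAt_boundaryTerm`) cancels the
tangential component and leaves f'' - f⁻³ - fτ² + Kf = 0 along N and (f²τ)' = 0 along B. Variations
by bump functions in the directions N and B show that both equations are necessary
(`isPBiharmonic_iff`).

The second equation says τ = bk. For the radius u = 1/k = f² the first reads 2uu'' - u'² = 4(1 + b²)
- 4Ku². Then C = (u'² + 4(1 + b²) + 4Ku²)/(4u) is conserved, and u solves the linear equation u'' =
2C - 4Ku. Its solutions are quadratic, trigonometric or exponential according to K, and the first
integral ties their constants together (`flat_eq`, `spherical_eq`, `hyperbolic_eq`). A constant u is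
possible only on the sphere, where the strict inequality b₂² > 4 + 4b₁² excludes it.

The equations are available only on the interior of I; the formulas reach the endpoints by
continuity. The frame itself is the normalized tension field completed by a vector product
(`exists_isFrenetFrame`). -/

open scoped ContDiff

open Set Filter Topology MeasureTheory

/-! ### Partial derivatives of maps of two variables, and differentiation under the integral sign.
-/

section TwoVariables

variable {V : Type*} [NormedAddCommGroup V] [NormedSpace ℝ V]

/-- The derivative of `F` in the constant direction `v`. -/
noncomputable def dirDeriv (v : ℝ × ℝ) (F : ℝ × ℝ → V) (q : ℝ × ℝ) : V := fderiv ℝ F q v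

theorem ContDiffOn.dirDeriv {F : ℝ × ℝ → V} {U : Set (ℝ × ℝ)} (hU : IsOpen U)
    (hF : ContDiffOn ℝ ∞ F U) (v : ℝ × ℝ) : ContDiffOn ℝ ∞ (dirDeriv v F) U :=
  (hF.fderiv_of_isOpen hU (m := ∞) (by simp)).clm_apply contDiffOn_const

theorem dirDeriv_comm {F : ℝ × ℝ → V} {U : Set (ℝ × ℝ)} (hU : IsOpen U)
    (hF : ContDiffOn ℝ ∞ F U) (v w : ℝ × ℝ) {q : ℝ × ℝ} (hq : q ∈ U) :
    dirDeriv v (dirDeriv w F) q = dirDeriv w (dirDeriv v F) q := by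
  have h1 : ContDiffAt ℝ ∞ F q := hF.contDiffAt (hU.mem_nhds hq)
  have h2 : DifferentiableAt ℝ (fderiv ℝ F) q :=
    ((hF.fderiv_of_isOpen hU (m := ∞) (by simp)).contDiffAt (hU.mem_nhds hq)).differentiableAt
      (by simp)
  have h3 : IsSymmSndFDerivAt ℝ F q := h1.isSymmSndFDerivAt (by simp; exact WithTop.coe_le_coe.2 (le_top : (2 : ℕ∞) ≤ ⊤))
  have h4 : ∀ v w : ℝ × ℝ, _root_.dirDeriv v (_root_.dirDeriv w F) q
      = fderiv ℝ (fderiv ℝ F) q v w := by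
    intro v w
    have : HasFDerivAt (fun q => fderiv ℝ F q w) _ q := h2.hasFDerivAt.clm_apply
      (hasFDerivAt_const w q)
    change fderiv ℝ (fun q => fderiv ℝ F q w) q v = _
    rw [this.fderiv]
    simp
  rw [h4, h4, h3.eq]

theorem hasDerivAt_fst_slice {F : ℝ × ℝ → V} {U : Set (ℝ × ℝ)} (hU : IsOpen U)
    (hF : ContDiffOn ℝ ∞ F U) {t s : ℝ} (hq : (t, s) ∈ U) :
    HasDerivAt (fun x => F (x, s)) (dirDeriv (1, 0) F (t, s)) t := by
  have h1 : HasFDerivAt F (fderiv ℝ F (t, s)) (t, s) :=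
    ((hF.contDiffAt (hU.mem_nhds hq)).differentiableAt (by simp)).hasFDerivAt
  exact h1.comp_hasDerivAt t ((hasDerivAt_id t).prodMk (hasDerivAt_const t s))

theorem hasDerivAt_snd_slice {F : ℝ × ℝ → V} {U : Set (ℝ × ℝ)} (hU : IsOpen U)
    (hF : ContDiffOn ℝ ∞ F U) {t s : ℝ} (hq : (t, s) ∈ U) :
    HasDerivAt (fun x => F (t, x)) (dirDeriv (0, 1) F (t, s)) s := by
  have h1 : HasFDerivAt F (fderiv ℝ F (t, s)) (t, s) :=
    ((hF.contDiffAt (hU.mem_nhds hq)).differentiableAt (by simp)).hasFDerivAt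
  exact h1.comp_hasDerivAt s ((hasDerivAt_const s t).prodMk (hasDerivAt_id s))

/-- Differentiation under the integral sign for a smooth integrand on a compact interval. -/
theorem hasDerivAt_intervalIntegral_of_contDiffOn {h : ℝ × ℝ → ℝ} {U : Set (ℝ × ℝ)}
    (hU : IsOpen U) (hh : ContDiffOn ℝ ∞ h U) {a b : ℝ} (hab : a ≤ b) {t₀ : ℝ}
    (hsub : ∀ s ∈ Icc a b, (t₀, s) ∈ U) :
    HasDerivAt (fun t => ∫ s in a..b, h (t, s)) (∫ s in a..b, dirDeriv (1, 0) h (t₀, s)) t₀ := by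
  -- A compact box around {t₀} × [a, b] stays inside U; the bound of the t-derivative on it is the
  -- dominating constant.
  obtain ⟨u, v, hu, -, h0u, hsv, huv⟩ := generalized_tube_lemma (isCompact_singleton (x := t₀))
    (isCompact_Icc (a := a) (b := b)) hU (by rintro ⟨t, s⟩ ⟨rfl, hs⟩; exact hsub s hs)
  obtain ⟨δ, hδ, hball⟩ := Metric.nhds_basis_closedBall.mem_iff.1 (hu.mem_nhds (h0u rfl))
  have hK : Metric.closedBall t₀ δ ×ˢ Icc a b ⊆ U := fun q hq => huv ⟨hball hq.1, hsv hq.2⟩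
  have hc : ContinuousOn (dirDeriv (1, 0) h) U := (hh.dirDeriv hU _).continuousOn
  obtain ⟨C, hC⟩ := ((isCompact_closedBall t₀ δ).prod (isCompact_Icc (a := a) (b := b))
    ).exists_bound_of_continuousOn (hc.mono hK)
  have hslice : ∀ t ∈ Metric.closedBall t₀ δ, ∀ g : ℝ × ℝ → ℝ, ContinuousOn g U →
      ContinuousOn (fun s => g (t, s)) (uIcc a b) := by
    intro t ht g hg
    rw [uIcc_of_le hab]
    exact hg.comp (by fun_prop) (fun s hs => hK ⟨ht, hs⟩)
  have ht₀ : t₀ ∈ Metric.closedBall t₀ δ := Metric.mem_closedBall_self hδ.le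
  refine (intervalIntegral.hasDerivAt_integral_of_dominated_loc_of_deriv_le
    (F' := fun t s => dirDeriv (1, 0) h (t, s)) (bound := fun _ => C)
    (Metric.closedBall_mem_nhds t₀ hδ) ?_ ?_ ?_ ?_ ?_ ?_).2
  · filter_upwards [Metric.closedBall_mem_nhds t₀ hδ] with t ht
    exact (hslice t ht h hh.continuousOn).intervalIntegrable.def'.aestronglyMeasurable
  · exact (hslice t₀ ht₀ h hh.continuousOn).intervalIntegrable
  · exact (hslice t₀ ht₀ _ hc).intervalIntegrable.def'.aestronglyMeasurable
  · refine Eventually.of_forall fun s hs t ht => hC (t, s) ⟨ht, ?_⟩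
    rw [← uIcc_of_le hab]; exact uIoc_subset_uIcc hs
  · exact intervalIntegrable_const
  · refine Eventually.of_forall fun s hs t ht => hasDerivAt_fst_slice hU hh (hK ⟨ht, ?_⟩)
    rw [← uIcc_of_le hab]; exact uIoc_subset_uIcc hs

end TwoVariables

/-! ### Common properties of the three models. -/

namespace SpaceFormModel

variable {V : Type*} [NormedAddCommGroup V] [NormedSpace ℝ V]

/-- The properties of the three models on which the theory of curves depends. The last field is
an oriented vector product on the tangent spaces. -/
structure IsSpaceForm (M : SpaceFormModel V) : Prop where
  symm : ∀ x y, M.form x y = M.form y x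
  curv_cases : M.curv = 0 ∨ M.curv = 1 ∨ M.curv = -1
  curv_mem : ∀ x ∈ M.carrier, M.curv * M.form x x = M.curv ^ 2
  normalize_mem : ∀ x ∈ M.carrier, ∀ v, M.curv * M.form x v = 0 → 0 < 1 + M.curv * M.form v v →
    (Real.sqrt (1 + M.curv * M.form v v))⁻¹ • (x + v) ∈ M.carrier
  pos : ∀ x ∈ M.carrier, ∀ v, M.curv * M.form x v = 0 → v ≠ 0 → 0 < M.form v v
  exists_cross : ∃ cr : V × V × V → V, ContDiff ℝ ∞ cr ∧
    ∀ x ∈ M.carrier, ∀ v w, M.curv * M.form x v = 0 → M.curv * M.form x w = 0 →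
      M.form v v = 1 → M.form w w = 1 → M.form v w = 0 →
      M.curv * M.form x (cr (x, v, w)) = 0 ∧ M.form (cr (x, v, w)) (cr (x, v, w)) = 1 ∧
      M.form v (cr (x, v, w)) = 0 ∧ M.form w (cr (x, v, w)) = 0 ∧
      ∀ d, M.curv * M.form x d = 0 → M.form v d = 0 → M.form w d = 0 →
        M.form (cr (x, v, w)) d = 0 → d = 0

variable {M : SpaceFormModel V}

/-- This is the only algebraic fact about K = 0, ±1 that the polynomial identities need, so they
require no case distinction. -/
theorem IsSpaceForm.curv_pow (hM : M.IsSpaceForm) : M.curv ^ 3 = M.curv := by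
  rcases hM.curv_cases with h | h | h <;> rw [h] <;> norm_num

variable [FiniteDimensional ℝ V]

theorem contDiffOn_form (M : SpaceFormModel V) {E : Type*} [NormedAddCommGroup E]
    [NormedSpace ℝ E] {n : WithTop ℕ∞} {f g : E → V} {S : Set E} (hf : ContDiffOn ℝ n f S)
    (hg : ContDiffOn ℝ n g S) : ContDiffOn ℝ n (fun x => M.form (f x) (g x)) S :=
  ((M.form.toContinuousBilinearMap.contDiff.comp_contDiffOn hf).clm_apply hg)

theorem hasDerivWithinAt_form (M : SpaceFormModel V) {f g : ℝ → V} {f' g' : V} {S : Set ℝ} {s : ℝ}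
    (hf : HasDerivWithinAt f f' S s) (hg : HasDerivWithinAt g g' S s) :
    HasDerivWithinAt (fun x => M.form (f x) (g x)) (M.form (f s) g' + M.form f' (g s)) S s :=
  M.form.toContinuousBilinearMap.hasDerivWithinAt_of_bilinear hf hg

theorem hasDerivAt_form (M : SpaceFormModel V) {f g : ℝ → V} {f' g' : V} {s : ℝ}
    (hf : HasDerivAt f f' s) (hg : HasDerivAt g g' s) :
    HasDerivAt (fun x => M.form (f x) (g x)) (M.form (f s) g' + M.form f' (g s)) s :=
  M.form.toContinuousBilinearMap.hasDerivAt_of_bilinear (fun _ => hf) (fun _ => hg)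

end SpaceFormModel

/-! ### Unit speed curves and the Frenet equations in ambient terms. -/

namespace SpaceFormModel

variable {V : Type*} [NormedAddCommGroup V] [NormedSpace ℝ V] {M : SpaceFormModel V}
  {I : Set ℝ} {γ N B : ℝ → V} {k τ : ℝ → ℝ}

theorem uniqueDiffOn_of_ordConnected (hI : I.OrdConnected) (hI' : (interior I).Nonempty) :
    UniqueDiffOn ℝ I := uniqueDiffOn_convex hI.convex hI'

theorem subset_closure_interior_of_ordConnected (hI : I.OrdConnected)
    (hI' : (interior I).Nonempty) : I ⊆ closure (interior I) := by
  rw [(hI.convex (𝕜 := ℝ)).closure_interior_eq_closure_of_nonempty_interior hI']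
  exact subset_closure

theorem hasDerivWithinAt_of_smooth {E : Type*} [NormedAddCommGroup E] [NormedSpace ℝ E]
    {f : ℝ → E} (hf : ContDiffOn ℝ ∞ f I) {s : ℝ} (hs : s ∈ I) :
    HasDerivWithinAt f (derivWithin f I s) I s :=
  (hf.differentiableOn (by simp) s hs).hasDerivWithinAt

/-- Tangency is always expressed with the factor K, so that it is an empty condition when K = 0. -/
theorem curv_mul_form_tangentProj (hM : M.IsSpaceForm) {x : V} (hx : x ∈ M.carrier) (v : V) :
    M.curv * M.form x (M.tangentProj x v) = 0 := by
  have h1 := hM.curv_mem x hx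
  have h2 := hM.curv_pow
  simp only [tangentProj, map_sub, map_smul, smul_eq_mul, hM.symm v x]
  linear_combination (-M.curv * M.form x v) * h1 - M.form x v * h2

variable [FiniteDimensional ℝ V]

/-- Differentiating a constant product. -/
theorem form_derivWithin_add {f g : ℝ → V} {c C : ℝ} (hU : UniqueDiffOn ℝ I)
    (hf : ContDiffOn ℝ ∞ f I) (hg : ContDiffOn ℝ ∞ g I)
    (h : ∀ s ∈ I, c * M.form (f s) (g s) = C) {s : ℝ} (hs : s ∈ I) :
    c * (M.form (f s) (derivWithin g I s) + M.form (derivWithin f I s) (g s)) = 0 := by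
  have h1 := (hasDerivWithinAt_form M (hasDerivWithinAt_of_smooth hf hs)
    (hasDerivWithinAt_of_smooth hg hs)).const_mul c
  have h2 : HasDerivWithinAt (fun x => c * M.form (f x) (g x)) 0 I s :=
    (hasDerivWithinAt_const s I C).congr (fun x hx => h x hx) (h s hs)
  exact (hU s hs).eq_deriv _ h1 h2

namespace IsUnitSpeedCurve

variable (hγ : M.IsUnitSpeedCurve I γ) (hM : M.IsSpaceForm) (hU : UniqueDiffOn ℝ I)
include hγ hU

omit [FiniteDimensional ℝ V] in
theorem smooth_deriv : ContDiffOn ℝ ∞ (derivWithin γ I) I := hγ.smooth.derivWithin hU (by simp)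

include hM

theorem form_tangent {s : ℝ} (hs : s ∈ I) : M.curv * M.form (γ s) (derivWithin γ I s) = 0 := by
  have h := form_derivWithin_add (M := M) hU hγ.smooth hγ.smooth
    (fun s hs => hM.curv_mem _ (hγ.mem s hs)) hs
  rw [hM.symm (derivWithin γ I s)] at h
  linarith

theorem form_tangent_deriv {s : ℝ} (hs : s ∈ I) :
    M.form (derivWithin γ I s) (derivWithin (derivWithin γ I) I s) = 0 := by
  have h := form_derivWithin_add (M := M) (c := 1) (C := 1) hU (hγ.smooth_deriv hU)
    (hγ.smooth_deriv hU) (fun s hs => by rw [hγ.unit_speed s hs, one_mul]) hs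
  rw [hM.symm (derivWithin (derivWithin γ I) I s)] at h
  linarith

/-- Differentiating K⟨γ,γ'⟩ = 0 gives K⟨γ,γ''⟩ = -K, which is the part of γ'' removed by the
projection. -/
theorem deriv_tangent {s : ℝ} (hs : s ∈ I) :
    derivWithin (derivWithin γ I) I s = M.tension I γ s - M.curv • γ s := by
  have h := form_derivWithin_add (M := M) hU hγ.smooth (hγ.smooth_deriv hU)
    (fun s hs => hγ.form_tangent hM hU hs) hs
  rw [hγ.unit_speed s hs, hM.symm] at h
  have h' : M.curv * M.form (derivWithin (derivWithin γ I) I s) (γ s) = -M.curv := by linarith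
  rw [tension, covDeriv, tangentProj, h']
  module

/-- The covariant derivative of a tangent field orthogonal to the curve is its derivative. -/
theorem covDeriv_eq {X : ℝ → V} (hX : ContDiffOn ℝ ∞ X I)
    (hXγ : ∀ s ∈ I, M.curv * M.form (γ s) (X s) = 0) {s : ℝ} (hs : s ∈ I)
    (hXT : M.form (derivWithin γ I s) (X s) = 0) : M.covDeriv I γ X s = derivWithin X I s := by
  have h := form_derivWithin_add (M := M) hU hγ.smooth hX hXγ hs
  rw [hXT, add_zero, hM.symm] at h
  rw [covDeriv, tangentProj, h, zero_smul, sub_zero]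

end IsUnitSpeedCurve

namespace IsFrenetFrame

variable (hF : M.IsFrenetFrame I γ k τ N B) (hγ : M.IsUnitSpeedCurve I γ) (hM : M.IsSpaceForm)
  (hU : UniqueDiffOn ℝ I)
include hF hM hγ

omit [FiniteDimensional ℝ V] in
theorem form_N {s : ℝ} (hs : s ∈ I) : M.curv * M.form (γ s) (N s) = 0 := by
  rw [← hF.tangent_N s hs]; exact curv_mul_form_tangentProj hM (hγ.mem s hs) _

omit [FiniteDimensional ℝ V] in
theorem form_B {s : ℝ} (hs : s ∈ I) : M.curv * M.form (γ s) (B s) = 0 := by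
  rw [← hF.tangent_B s hs]; exact curv_mul_form_tangentProj hM (hγ.mem s hs) _

include hU

theorem deriv_T {s : ℝ} (hs : s ∈ I) :
    derivWithin (derivWithin γ I) I s = k s • N s - M.curv • γ s := by
  rw [hγ.deriv_tangent hM hU hs, tension, hF.cov_T s hs]

theorem deriv_N {s : ℝ} (hs : s ∈ I) :
    derivWithin N I s = -(k s) • derivWithin γ I s + τ s • B s := by
  rw [← hF.cov_N s hs, hγ.covDeriv_eq hM hU hF.smooth_N (fun s hs => hF.form_N hγ hM hs) hs
    (hF.orth_TN s hs)]

theorem deriv_B {s : ℝ} (hs : s ∈ I) : derivWithin B I s = -(τ s) • N s := by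
  rw [← hF.cov_B s hs, hγ.covDeriv_eq hM hU hF.smooth_B (fun s hs => hF.form_B hγ hM hs) hs
    (hF.orth_TB s hs)]

/-- Smoothness of k and τ is not part of the frame; it follows from k = ⟨T' + Kγ, N⟩ and τ = ⟨N',
B⟩. -/
theorem smooth_k : ContDiffOn ℝ ∞ k I := by
  have h1 : ContDiffOn ℝ ∞ (derivWithin (derivWithin γ I) I) I :=
    (hγ.smooth_deriv hU).derivWithin hU (by simp)
  have h2 := contDiffOn_form M (h1.add (hγ.smooth.const_smul M.curv)) hF.smooth_N
  refine h2.congr fun s hs => ?_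
  simp [hF.deriv_T hγ hM hU hs, hF.unit_N s hs]

theorem smooth_τ : ContDiffOn ℝ ∞ τ I := by
  have h2 := contDiffOn_form M (hF.smooth_N.derivWithin hU (m := ∞) (by simp)) hF.smooth_B
  refine h2.congr fun s hs => ?_
  simp [hF.deriv_N hγ hM hU hs, hF.unit_B s hs, hF.orth_TB s hs]

omit hU hγ hM [FiniteDimensional ℝ V] in
theorem len_tension {s : ℝ} (hs : s ∈ I) : M.len (M.tension I γ s) = k s := by
  rw [tension, hF.cov_T s hs, len]
  simp only [map_smul, LinearMap.smul_apply, hF.unit_N s hs, smul_eq_mul, mul_one]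
  exact Real.sqrt_mul_self (hF.k_pos s hs).le

end IsFrenetFrame

end SpaceFormModel

/-! ### The first variation before integration by parts. -/

namespace SpaceFormModel

variable {V : Type*} [NormedAddCommGroup V] [NormedSpace ℝ V] {M : SpaceFormModel V}
  {I : Set ℝ} {γ N B : ℝ → V} {k τ : ℝ → ℝ}

/-- The squared length of the tension field of a curve with velocity `v` and acceleration `a`. -/
noncomputable def tensionSq (M : SpaceFormModel V) (v a : V) : ℝ :=
  M.form a a - M.curv * M.form v v ^ 2

/-- Since K⟨x,x⟩ = K² and K³ = K, the projection has square ⟨a,a⟩ - K⟨x,a⟩²; the hypothesis replaces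
K⟨x,a⟩² by K⟨v,v⟩². -/
theorem form_tangentProj_self (hM : M.IsSpaceForm) {x : V} (hx : x ∈ M.carrier) {v a : V}
    (h : M.curv * (M.form x a + M.form v v) = 0) :
    M.form (M.tangentProj x a) (M.tangentProj x a) = M.tensionSq v a := by
  have h1 := hM.curv_mem x hx
  have h2 := hM.curv_pow
  simp only [tangentProj, tensionSq, map_sub, map_smul, smul_eq_mul, LinearMap.sub_apply,
    LinearMap.smul_apply, hM.symm a x]
  linear_combination (M.curv * M.form x a ^ 2) * h1 + M.form x a ^ 2 * h2 -
    (M.form x a - M.form v v) * h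

theorem rpow_quarter_eq {x : ℝ} (hx : 0 ≤ x) : Real.sqrt x ^ ((1 : ℝ) / 2) = x ^ ((1 : ℝ) / 4) := by
  rw [Real.sqrt_eq_rpow, ← Real.rpow_mul hx]; norm_num

/-- With x = k this is the weight k^(-3/2) produced by differentiating the power 1/4 of k². -/
theorem sq_rpow_neg_three_quarters {x : ℝ} (hx : 0 < x) :
    (x ^ 2) ^ ((1 : ℝ) / 4 - 1) = (Real.sqrt x)⁻¹ ^ 3 := by
  rw [Real.sqrt_eq_rpow, ← Real.rpow_neg hx.le, ← Real.rpow_natCast, ← Real.rpow_natCast,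
    ← Real.rpow_mul hx.le, ← Real.rpow_mul hx.le]
  norm_num

variable [FiniteDimensional ℝ V]

theorem IsFrenetFrame.tensionSq_eq (hF : M.IsFrenetFrame I γ k τ N B)
    (hγ : M.IsUnitSpeedCurve I γ) (hM : M.IsSpaceForm) (hU : UniqueDiffOn ℝ I) {s : ℝ}
    (hs : s ∈ I) :
    M.tensionSq (derivWithin γ I s) (derivWithin (derivWithin γ I) I s) = k s ^ 2 := by
  have h1 := hM.curv_mem _ (hγ.mem s hs)
  have h2 := hM.curv_pow
  have h3 := hF.form_N hγ hM hs
  rw [tensionSq, hγ.unit_speed s hs, hF.deriv_T hγ hM hU hs]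
  simp only [map_sub, map_smul, smul_eq_mul, LinearMap.sub_apply,
    LinearMap.smul_apply, hF.unit_N s hs, hM.symm (N s) (γ s)]
  linear_combination M.curv * h1 + h2 - 2 * k s * h3

variable {a b ε : ℝ} {Γ : ℝ → ℝ → V}

namespace IsVariation

variable (hΓ : M.IsVariation I γ a b ε Γ) (hU : UniqueDiffOn ℝ I)
include hΓ

omit [FiniteDimensional ℝ V] in
theorem smooth_interior :
    ContDiffOn ℝ ∞ (fun q : ℝ × ℝ => Γ q.1 q.2) (Ioo (-ε) ε ×ˢ interior I) :=
  hΓ.smooth.mono (prod_mono_right interior_subset)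

include hU

omit [FiniteDimensional ℝ V] in
theorem velocity_eq {t s : ℝ} (ht : t ∈ Ioo (-ε) ε) (hs : s ∈ interior I) :
    derivWithin (Γ t) I s = dirDeriv (0, 1) (fun q : ℝ × ℝ => Γ q.1 q.2) (t, s) :=
  (hasDerivAt_snd_slice (isOpen_Ioo.prod isOpen_interior) hΓ.smooth_interior
    (mk_mem_prod ht hs)).hasDerivWithinAt.derivWithin (hU s (interior_subset hs))

omit [FiniteDimensional ℝ V] in
theorem acceleration_eq {t s : ℝ} (ht : t ∈ Ioo (-ε) ε) (hs : s ∈ interior I) :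
    derivWithin (derivWithin (Γ t) I) I s =
      dirDeriv (0, 1) (dirDeriv (0, 1) (fun q : ℝ × ℝ => Γ q.1 q.2)) (t, s) := by
  have h := hasDerivAt_snd_slice (isOpen_Ioo.prod isOpen_interior)
    (hΓ.smooth_interior.dirDeriv (isOpen_Ioo.prod isOpen_interior) (0, 1)) (mk_mem_prod ht hs)
  have h2 := h.congr_of_eventuallyEq (f₁ := derivWithin (Γ t) I) (by
    filter_upwards [isOpen_interior.mem_nhds hs] with x hx using hΓ.velocity_eq hU ht hx)
  exact h2.hasDerivWithinAt.derivWithin (hU s (interior_subset hs))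

omit [FiniteDimensional ℝ V] in
theorem velocity_zero {s : ℝ} (hs : s ∈ interior I) :
    dirDeriv (0, 1) (fun q : ℝ × ℝ => Γ q.1 q.2) (0, s) = derivWithin γ I s := by
  rw [← hΓ.velocity_eq hU (by simp [hΓ.eps_pos]) hs]
  exact derivWithin_congr hΓ.initial (hΓ.initial s (interior_subset hs))

omit [FiniteDimensional ℝ V] in
theorem acceleration_zero {s : ℝ} (hs : s ∈ interior I) :
    dirDeriv (0, 1) (dirDeriv (0, 1) (fun q : ℝ × ℝ => Γ q.1 q.2)) (0, s) =
      derivWithin (derivWithin γ I) I s := by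
  rw [← hΓ.acceleration_eq hU (by simp [hΓ.eps_pos]) hs]
  have h : ∀ x ∈ I, derivWithin (Γ 0) I x = derivWithin γ I x := fun x hx =>
    derivWithin_congr hΓ.initial (hΓ.initial x hx)
  exact derivWithin_congr h (h s (interior_subset hs))

theorem len_tension (hM : M.IsSpaceForm) {t s : ℝ} (ht : t ∈ Ioo (-ε) ε) (hs : s ∈ interior I) :
    M.len (M.tension I (Γ t) s) = Real.sqrt
      (M.tensionSq (dirDeriv (0, 1) (fun q : ℝ × ℝ => Γ q.1 q.2) (t, s))
        (dirDeriv (0, 1) (dirDeriv (0, 1) (fun q : ℝ × ℝ => Γ q.1 q.2)) (t, s))) := by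
  have hsm : ContDiffOn ℝ ∞ (Γ t) I :=
    hΓ.smooth.comp (f := fun x : ℝ => (t, x)) (by fun_prop) (fun x hx => ⟨ht, hx⟩)
  have hmem := hΓ.mem t ht
  have h1 : ∀ x ∈ I, M.curv * M.form (Γ t x) (derivWithin (Γ t) I x) = 0 := by
    intro x hx
    have h := form_derivWithin_add (M := M) hU hsm hsm (fun s hs => hM.curv_mem _ (hmem s hs)) hx
    rw [hM.symm (derivWithin (Γ t) I x)] at h
    linarith
  have hsI := interior_subset hs
  have h2 := form_derivWithin_add (M := M) hU hsm (hsm.derivWithin hU (m := ∞) (by simp)) h1 hsI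
  rw [len, tension, covDeriv, form_tangentProj_self hM (hmem s hsI) h2,
    hΓ.velocity_eq hU ht hs, hΓ.acceleration_eq hU ht hs]

theorem pBienergy_eq (hM : M.IsSpaceForm) {t : ℝ} (ht : t ∈ Ioo (-ε) ε)
    (hpos : ∀ s ∈ Icc a b, 0 ≤ M.tensionSq (dirDeriv (0, 1) (fun q : ℝ × ℝ => Γ q.1 q.2) (t, s))
        (dirDeriv (0, 1) (dirDeriv (0, 1) (fun q : ℝ × ℝ => Γ q.1 q.2)) (t, s))) :
    M.pBienergy (1 / 2) I a b (Γ t) = ∫ s in a..b, 2 *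
      M.tensionSq (dirDeriv (0, 1) (fun q : ℝ × ℝ => Γ q.1 q.2) (t, s))
        (dirDeriv (0, 1) (dirDeriv (0, 1) (fun q : ℝ × ℝ => Γ q.1 q.2)) (t, s)) ^
          ((1 : ℝ) / 4) := by
  rw [pBienergy, ← intervalIntegral.integral_const_mul]
  refine intervalIntegral.integral_congr fun s hs => ?_
  rw [uIcc_of_le hΓ.lt.le] at hs
  simp only [hΓ.len_tension hU hM ht (hΓ.subset hs), rpow_quarter_eq (hpos s hs)]
  norm_num

end IsVariation

/-- The first variation of the `1/2`-bienergy, before integration by parts. -/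
theorem IsVariation.exists_variationField (hΓ : M.IsVariation I γ a b ε Γ)
    (hU : UniqueDiffOn ℝ I) (hM : M.IsSpaceForm) (hγ : M.IsUnitSpeedCurve I γ)
    (hF : M.IsFrenetFrame I γ k τ N B) :
    ∃ X X' X'' : ℝ → V,
      (∀ s ∈ interior I, HasDerivAt (fun t => Γ t s) (X s) 0) ∧
      (∀ s ∈ interior I, HasDerivAt X (X' s) s) ∧
      (∀ s ∈ interior I, HasDerivAt X' (X'' s) s) ∧
      ContinuousOn X'' (interior I) ∧
      (∀ s ∈ interior I, M.curv * M.form (X s) (γ s) = 0) ∧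
      (∀ s ∈ interior I \ Icc a b, X s = 0) ∧
      HasDerivAt (fun t => M.pBienergy (1 / 2) I a b (Γ t))
        (∫ s in a..b, (Real.sqrt (k s))⁻¹ ^ 3 *
          (M.form (X'' s) (derivWithin (derivWithin γ I) I s) -
            2 * M.curv * M.form (X' s) (derivWithin γ I s))) 0 := by
  set F : ℝ × ℝ → V := fun q => Γ q.1 q.2 with hFdef
  set U := Ioo (-ε) ε ×ˢ interior I with hUdef
  have hUo : IsOpen U := isOpen_Ioo.prod isOpen_interior
  have hs0 : ContDiffOn ℝ ∞ F U := hΓ.smooth_interior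
  have h0 : (0 : ℝ) ∈ Ioo (-ε) ε := by simp [hΓ.eps_pos]
  have hst : ContDiffOn ℝ ∞ (dirDeriv (1, 0) F) U := hs0.dirDeriv hUo _
  have hst1 : ContDiffOn ℝ ∞ (dirDeriv (0, 1) (dirDeriv (1, 0) F)) U := hst.dirDeriv hUo _
  have hst2 : ContDiffOn ℝ ∞ (dirDeriv (0, 1) (dirDeriv (0, 1) (dirDeriv (1, 0) F))) U :=
    hst1.dirDeriv hUo _
  have hs1 : ContDiffOn ℝ ∞ (dirDeriv (0, 1) F) U := hs0.dirDeriv hUo _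
  have hs2 : ContDiffOn ℝ ∞ (dirDeriv (0, 1) (dirDeriv (0, 1) F)) U := hs1.dirDeriv hUo _
  have hXd : ∀ s ∈ interior I, HasDerivAt (fun t => Γ t s) (dirDeriv (1, 0) F (0, s)) 0 :=
    fun s hs => hasDerivAt_fst_slice hUo hs0 (mk_mem_prod h0 hs)
  refine ⟨fun s => dirDeriv (1, 0) F (0, s), fun s => dirDeriv (0, 1) (dirDeriv (1, 0) F) (0, s),
    fun s => dirDeriv (0, 1) (dirDeriv (0, 1) (dirDeriv (1, 0) F)) (0, s), hXd,
    fun s hs => hasDerivAt_snd_slice hUo hst (mk_mem_prod h0 hs),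
    fun s hs => hasDerivAt_snd_slice hUo hst1 (mk_mem_prod h0 hs),
    hst2.continuousOn.comp (by fun_prop) (fun s hs => mk_mem_prod h0 hs), ?_, ?_, ?_⟩
  · intro s hs
    have h1 := (hasDerivAt_form M (hXd s hs) (hXd s hs)).const_mul M.curv
    have h2 : HasDerivAt (fun t => M.curv * M.form (Γ t s) (Γ t s)) 0 0 := by
      refine (hasDerivAt_const (0 : ℝ) (M.curv ^ 2)).congr_of_eventuallyEq ?_
      filter_upwards [Ioo_mem_nhds h0.1 h0.2] with t ht
      exact hM.curv_mem _ (hΓ.mem t ht s (interior_subset hs))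
    have h3 := h1.unique h2
    rw [hM.symm (Γ 0 s), hΓ.initial s (interior_subset hs)] at h3
    linarith
  · intro s hs
    refine (hXd s hs.1).unique ((hasDerivAt_const (0 : ℝ) (γ s)).congr_of_eventuallyEq ?_)
    filter_upwards [Ioo_mem_nhds h0.1 h0.2] with t ht
    exact hΓ.fixed t ht s ⟨interior_subset hs.1, hs.2⟩
  · set w : ℝ × ℝ → ℝ := fun q =>
      M.tensionSq (dirDeriv (0, 1) F q) (dirDeriv (0, 1) (dirDeriv (0, 1) F) q) with hw
    have hws : ContDiffOn ℝ ∞ w U :=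
      (contDiffOn_form M hs2 hs2).sub (contDiffOn_const.mul ((contDiffOn_form M hs1 hs1).pow 2))
    have hw0 : ∀ s ∈ interior I, w (0, s) = k s ^ 2 := by
      intro s hs
      simp only [hw, hFdef]
      rw [hΓ.velocity_zero hU hs, hΓ.acceleration_zero hU hs,
        hF.tensionSq_eq hγ hM hU (interior_subset hs)]
    -- The power 1/4 is smooth only where the squared tension is positive; this open set contains
    -- {0} × [a, b] because k > 0 there.
    set U' := U ∩ w ⁻¹' Ioi 0 with hU'
    have hU'o : IsOpen U' := hws.continuousOn.isOpen_inter_preimage hUo isOpen_Ioi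
    have hsub : ∀ s ∈ Icc a b, (0, s) ∈ U' := by
      intro s hs
      have hsJ := hΓ.subset hs
      refine ⟨mk_mem_prod h0 hsJ, ?_⟩
      rw [mem_preimage, hw0 s hsJ]
      exact pow_pos (hF.k_pos s (interior_subset hsJ)) 2
    set h : ℝ × ℝ → ℝ := fun q => 2 * w q ^ ((1 : ℝ) / 4) with hh
    have hhs : ContDiffOn ℝ ∞ h U' :=
      contDiffOn_const.mul ((hws.mono inter_subset_left).rpow_const_of_ne
        fun q hq => ne_of_gt hq.2)
    have hmain := hasDerivAt_intervalIntegral_of_contDiffOn hU'o hhs hΓ.lt.le hsub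
    have hcongr : (∫ s in a..b, dirDeriv (1, 0) h (0, s)) = ∫ s in a..b, (Real.sqrt (k s))⁻¹ ^ 3 *
          (M.form (dirDeriv (0, 1) (dirDeriv (0, 1) (dirDeriv (1, 0) F)) (0, s))
            (derivWithin (derivWithin γ I) I s) -
            2 * M.curv * M.form (dirDeriv (0, 1) (dirDeriv (1, 0) F) (0, s))
              (derivWithin γ I s)) := by
      refine intervalIntegral.integral_congr fun s hs => ?_
      rw [uIcc_of_le hΓ.lt.le] at hs
      have hsJ := hΓ.subset hs
      have hq : ((0 : ℝ), s) ∈ U := mk_mem_prod h0 hsJ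
      have h1 := hasDerivAt_fst_slice hU'o hhs (hsub s hs)
      have hv := hasDerivAt_fst_slice hUo hs1 hq
      have ha := hasDerivAt_fst_slice hUo hs2 hq
      have hwd := ((hasDerivAt_form M ha ha).sub
        (((hasDerivAt_form M hv hv).pow 2).const_mul M.curv))
      have h2 := (HasDerivAt.rpow_const (p := (1 : ℝ) / 4) hwd
        (Or.inl (ne_of_gt (hsub s hs).2))).const_mul 2
      have h3 := h1.unique h2
      have e1 : dirDeriv (1, 0) (dirDeriv (0, 1) F) (0, s) =
          dirDeriv (0, 1) (dirDeriv (1, 0) F) (0, s) := dirDeriv_comm hUo hs0 _ _ hq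
      -- The t-derivative is moved inwards past two s-derivatives; the second exchange takes place
      -- under a derivative and needs equality near the point.
      have e2 : dirDeriv (1, 0) (dirDeriv (0, 1) (dirDeriv (0, 1) F)) (0, s) =
          dirDeriv (0, 1) (dirDeriv (0, 1) (dirDeriv (1, 0) F)) (0, s) := by
        rw [dirDeriv_comm hUo hs1 _ _ hq]
        simp only [dirDeriv]
        congr 1
        refine Filter.EventuallyEq.fderiv_eq ?_
        filter_upwards [hUo.mem_nhds hq] with q hq
        exact dirDeriv_comm hUo hs0 _ _ hq
      have e3 : ((fun x => M.form (dirDeriv (0, 1) (dirDeriv (0, 1) F) (x, s))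
          (dirDeriv (0, 1) (dirDeriv (0, 1) F) (x, s))) - fun x => M.curv *
          ((fun x => M.form (dirDeriv (0, 1) F (x, s)) (dirDeriv (0, 1) F (x, s))) ^ 2) x) 0
          = k s ^ 2 := hw0 s hsJ
      have hkp := hF.k_pos s (interior_subset hsJ)
      rw [e3, sq_rpow_neg_three_quarters hkp, e1, e2] at h3
      simp only [hFdef] at h3 ⊢
      rw [hΓ.velocity_zero hU hsJ, hΓ.acceleration_zero hU hsJ,
        hγ.unit_speed s (interior_subset hsJ), hM.symm (derivWithin γ I s),
        hM.symm (derivWithin (derivWithin γ I) I s)] at h3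
      rw [h3]
      push_cast
      ring
    rw [← hcongr]
    refine hmain.congr_of_eventuallyEq ?_
    -- By compactness of [a, b], positivity of the squared tension holds for all s simultaneously
    -- once t is small.
    obtain ⟨u, v, hu, -, h0u, hsv, huv⟩ := generalized_tube_lemma
      (isCompact_singleton (x := (0 : ℝ))) (isCompact_Icc (a := a) (b := b)) hU'o
      (by rintro ⟨t, s⟩ ⟨rfl, hs⟩; exact hsub s hs)
    filter_upwards [Ioo_mem_nhds h0.1 h0.2, hu.mem_nhds (h0u rfl)] with t ht htu
    exact hΓ.pBienergy_eq hU hM ht fun s hs =>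
      le_of_lt (huv (mk_mem_prod htu (hsv hs))).2

end SpaceFormModel

/-! ### The Euler-Lagrange operator and integration by parts. -/

/-- The normal component of the Euler-Lagrange operator, up to a positive factor. -/
noncomputable def eulerLagrangeN (K : ℝ) (k τ : ℝ → ℝ) (s : ℝ) : ℝ :=
  2 * (k s)⁻¹ * deriv (deriv fun x => (k x)⁻¹) s - deriv (fun x => (k x)⁻¹) s ^ 2 -
    4 * (1 + (τ s / k s) ^ 2) + 4 * K * (k s)⁻¹ ^ 2

/-- The binormal component of the Euler-Lagrange operator, up to a positive factor. -/
noncomputable def eulerLagrangeB (k τ : ℝ → ℝ) (s : ℝ) : ℝ := deriv (fun x => τ x / k x) s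

theorem ContDiffOn.hasDerivAt_deriv {E : Type*} [NormedAddCommGroup E] [NormedSpace ℝ E]
    {f : ℝ → E} {J : Set ℝ} (hJ : IsOpen J) (hf : ContDiffOn ℝ ∞ f J) {s : ℝ} (hs : s ∈ J) :
    HasDerivAt f (deriv f s) s :=
  ((hf.contDiffAt (hJ.mem_nhds hs)).differentiableAt (by simp)).hasDerivAt

/-- The Euler-Lagrange operator in terms of the square root `f` of the radius of curvature. -/
theorem eulerLagrange_eq {J : Set ℝ} (hJ : IsOpen J) {K : ℝ} {k τ f : ℝ → ℝ}
    (hf : ContDiffOn ℝ ∞ f J) (hτ : ContDiffOn ℝ ∞ τ J) (hf0 : ∀ s ∈ J, 0 < f s)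
    (hk : ∀ s ∈ J, k s = (f s)⁻¹ ^ 2) {s : ℝ} (hs : s ∈ J) :
    eulerLagrangeN K k τ s = 4 * f s ^ 3 *
      (deriv (deriv f) s - (f s)⁻¹ ^ 3 - f s * τ s ^ 2 + K * f s) ∧
    eulerLagrangeB k τ s = f s * (2 * deriv f s * τ s + f s * deriv τ s) := by
  have hf1 : ContDiffOn ℝ ∞ (deriv f) J := hf.deriv_of_isOpen hJ (by simp)
  have hu : ∀ s ∈ J, HasDerivAt (fun x => (k x)⁻¹) (2 * f s * deriv f s) s := by
    intro s hs
    have h := ((hf.hasDerivAt_deriv hJ hs).pow 2).congr_of_eventuallyEq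
      (f₁ := fun x => (k x)⁻¹) (by
        filter_upwards [hJ.mem_nhds hs] with x hx
        simp [hk x hx])
    simpa using h
  have hu2 : HasDerivAt (deriv fun x => (k x)⁻¹)
      (2 * (deriv f s * deriv f s + f s * deriv (deriv f) s)) s := by
    refine (((hf.hasDerivAt_deriv hJ hs).mul (hf1.hasDerivAt_deriv hJ hs)).const_mul
      2).congr_of_eventuallyEq ?_
    filter_upwards [hJ.mem_nhds hs] with x hx
    rw [(hu x hx).deriv]
    simp [mul_assoc]
  have hb : HasDerivAt (fun x => τ x / k x) _ s :=
    (((hf.hasDerivAt_deriv hJ hs).pow 2).mul (hτ.hasDerivAt_deriv hJ hs)).congr_of_eventuallyEq (by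
        filter_upwards [hJ.mem_nhds hs] with x hx
        simp [hk x hx, div_eq_mul_inv, mul_comm])
  have h0 := (hf0 s hs).ne'
  rw [eulerLagrangeN, eulerLagrangeB, hb.deriv, hu2.deriv, (hu s hs).deriv, hk s hs]
  constructor
  · field_simp; ring
  · simp; ring

namespace SpaceFormModel

variable {V : Type*} [NormedAddCommGroup V] [NormedSpace ℝ V] {M : SpaceFormModel V}
  {I : Set ℝ} {γ N B : ℝ → V} {k τ : ℝ → ℝ}

variable [FiniteDimensional ℝ V] {a b ε : ℝ} {Γ : ℝ → ℝ → V}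

/-- The pointwise identity behind the integration by parts in the first variation formula. -/
theorem hasDerivAt_boundaryTerm {J : Set ℝ} (hJ : IsOpen J)
    {f : ℝ → ℝ} (hf : ContDiffOn ℝ ∞ f J) (hτ : ContDiffOn ℝ ∞ τ J) {T : ℝ → V} {s : ℝ} (hs : s ∈ J)
    (hf0 : 0 < f s) (hγ : HasDerivAt γ (T s) s)
    (hT : HasDerivAt T ((f s)⁻¹ ^ 2 • N s - M.curv • γ s) s)
    (hN : HasDerivAt N (-((f s)⁻¹ ^ 2) • T s + τ s • B s) s) (hB : HasDerivAt B (-(τ s) • N s) s)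
    {X X' : ℝ → V} {X'' : V} (hX : HasDerivAt X (X' s) s) (hX' : HasDerivAt X' X'' s)
    (hXγ : M.curv * M.form (X s) (γ s) = 0) :
    HasDerivAt (fun s => M.form (X' s) (f s • N s - (M.curv * f s ^ 3) • γ s) -
      M.form (X s) (deriv f s • N s - (f s)⁻¹ • T s + (f s * τ s) • B s -
        (3 * M.curv * f s ^ 2 * deriv f s) • γ s + (M.curv * f s ^ 3) • T s))
      (f s ^ 3 * (M.form X'' ((f s)⁻¹ ^ 2 • N s - M.curv • γ s) - 2 * M.curv * M.form (X' s) (T s))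
        - ((deriv (deriv f) s - (f s)⁻¹ ^ 3 - f s * τ s ^ 2 + M.curv * f s) * M.form (X s) (N s) +
          (2 * deriv f s * τ s + f s * deriv τ s) * M.form (X s) (B s))) s := by
  have hf1 := hf.hasDerivAt_deriv hJ hs
  have hf2 := (hf.deriv_of_isOpen hJ (m := ∞) (by simp)).hasDerivAt_deriv hJ hs
  have hτ1 := hτ.hasDerivAt_deriv hJ hs
  have h0 := hf0.ne'
  -- Here G = fN - Kf³γ equals f³γ'', and the field paired with X in the boundary term is R = G' +
  -- 2Kf³T, where 2Kf³T absorbs the term in ⟨X',T⟩. The components of R' along T cancel.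
  have hG := (hf1.smul hN).sub (((hf1.pow 3).const_mul M.curv).smul hγ)
  have hR := ((((hf2.smul hN).sub ((hf1.inv h0).smul hT)).add ((hf1.mul hτ1).smul hB)).sub
    ((((hf1.pow 2).const_mul (3 * M.curv)).mul hf2).smul hγ)).add
      (((hf1.pow 3).const_mul M.curv).smul hT)
  have h := (hasDerivAt_form M hX' hG).sub (hasDerivAt_form M hX hR)
  refine h.congr_deriv ?_
  simp only [map_sub, map_add, map_smul, smul_eq_mul, Pi.add_apply, Pi.sub_apply, Pi.mul_apply, Pi.pow_apply, Pi.smul_apply',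
    Pi.inv_apply]
  -- The coefficient is that of Kγ in R'; it is harmless because K⟨X,γ⟩ = 0.
  linear_combination (norm := (field_simp; ring)) -((f s)⁻¹ - 3 * (2 * f s * deriv f s ^ 2 +
    f s ^ 2 * deriv (deriv f) s) - M.curv * f s ^ 3) * hXγ

/-- The first variation formula for the `1/2`-bienergy. -/
theorem IsVariation.exists_firstVariation (hΓ : M.IsVariation I γ a b ε Γ)
    (hU : UniqueDiffOn ℝ I) (hM : M.IsSpaceForm) (hγ : M.IsUnitSpeedCurve I γ)
    (hF : M.IsFrenetFrame I γ k τ N B) :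
    ∃ X : ℝ → V, (∀ s ∈ interior I, HasDerivAt (fun t => Γ t s) (X s) 0) ∧
      ContinuousOn X (interior I) ∧
      HasDerivAt (fun t => M.pBienergy (1 / 2) I a b (Γ t))
        (∫ s in a..b, (Real.sqrt (k s) ^ 3 / 4 * eulerLagrangeN M.curv k τ s * M.form (X s) (N s) +
          Real.sqrt (k s) * eulerLagrangeB k τ s * M.form (X s) (B s))) 0 := by
  obtain ⟨X, X', X'', hXd, hX, hX', hX'', hXγ, hX0, hE⟩ :=
    hΓ.exists_variationField hU hM hγ hF
  refine ⟨X, hXd, fun s hs => (hX s hs).continuousAt.continuousWithinAt, ?_⟩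
  have hJ : IsOpen (interior I) := isOpen_interior
  have hk := (hF.smooth_k hγ hM hU).mono interior_subset
  have hτ := (hF.smooth_τ hγ hM hU).mono interior_subset
  have hkp : ∀ s ∈ interior I, 0 < k s := fun s hs => hF.k_pos s (interior_subset hs)
  set f : ℝ → ℝ := fun s => (Real.sqrt (k s))⁻¹ with hfdef
  have hf : ContDiffOn ℝ ∞ f (interior I) :=
    (hk.sqrt fun s hs => (hkp s hs).ne').inv fun s hs => (Real.sqrt_pos.2 (hkp s hs)).ne'
  have hf0 : ∀ s ∈ interior I, 0 < f s := fun s hs => inv_pos.2 (Real.sqrt_pos.2 (hkp s hs))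
  have hkf : ∀ s ∈ interior I, k s = (f s)⁻¹ ^ 2 := by
    intro s hs
    rw [hfdef, inv_inv, Real.sq_sqrt (hkp s hs).le]
  have hd : ∀ g : ℝ → V, ContDiffOn ℝ ∞ g I → ∀ s ∈ interior I,
      HasDerivAt g (derivWithin g I s) s := fun g hg s hs =>
    (hasDerivWithinAt_of_smooth hg (interior_subset hs)).hasDerivAt (mem_interior_iff_mem_nhds.1 hs)
  have hT : ∀ s ∈ interior I, derivWithin (derivWithin γ I) I s =
      (f s)⁻¹ ^ 2 • N s - M.curv • γ s := by
    intro s hs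
    rw [hF.deriv_T hγ hM hU (interior_subset hs), hkf s hs]
  have hΦ := fun s (hs : s ∈ interior I) => hasDerivAt_boundaryTerm hJ hf hτ hs
    (hf0 s hs) (hd γ hγ.smooth s hs)
    ((hd _ (hγ.smooth_deriv hU) s hs).congr_deriv (hT s hs))
    ((hd N hF.smooth_N s hs).congr_deriv
      (by rw [hF.deriv_N hγ hM hU (interior_subset hs), hkf s hs]))
    ((hd B hF.smooth_B s hs).congr_deriv (hF.deriv_B hγ hM hU (interior_subset hs)))
    (hX s hs) (hX' s hs) (hXγ s hs)
  set Φ : ℝ → ℝ := fun s => M.form (X' s) (f s • N s - (M.curv * f s ^ 3) • γ s) -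
      M.form (X s) (deriv f s • N s - (f s)⁻¹ • derivWithin γ I s + (f s * τ s) • B s -
        (3 * M.curv * f s ^ 2 * deriv f s) • γ s + (M.curv * f s ^ 3) • derivWithin γ I s)
    with hΦdef
  have hΦ0 : ∀ s ∈ interior I \ Icc a b, Φ s = 0 := by
    intro s hs
    have h1 : X =ᶠ[𝓝 s] fun _ => 0 := by
      filter_upwards [(hJ.sdiff isClosed_Icc).mem_nhds hs] with x hx using hX0 x hx
    have h2 : X' s = 0 :=
      (hX s hs.1).unique ((hasDerivAt_const s (0 : V)).congr_of_eventuallyEq h1)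
    simp [hΦdef, h2, hX0 s hs]
  -- The variation is known to be trivial only outside the closed interval, so the boundary terms at
  -- a and b vanish as limits from outside.
  have hends : ∀ s ∈ Icc a b, (∃ᶠ x in 𝓝 s, x ∉ Icc a b) → Φ s = 0 := by
    intro s hs hfr
    have hc : Tendsto Φ (𝓝 s) (𝓝 (Φ s)) := (hΦ s (hΓ.subset hs)).continuousAt
    by_contra hne
    refine hfr ?_
    filter_upwards [hc.eventually_ne hne, hJ.mem_nhds (hΓ.subset hs)] with x hx hxJ hxn
    exact hx (hΦ0 x ⟨hxJ, hxn⟩)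
  have ha : Φ a = 0 := by
    refine hends a (left_mem_Icc.2 hΓ.lt.le) ?_
    have h : ∃ᶠ x in 𝓝[<] a, x ∉ Icc a b := Eventually.frequently (by
      filter_upwards [self_mem_nhdsWithin] with x hx h using not_le.2 hx h.1)
    exact h.filter_mono nhdsWithin_le_nhds
  have hb : Φ b = 0 := by
    refine hends b (right_mem_Icc.2 hΓ.lt.le) ?_
    have h : ∃ᶠ x in 𝓝[>] b, x ∉ Icc a b := Eventually.frequently (by
      filter_upwards [self_mem_nhdsWithin] with x hx h using not_le.2 hx h.2)
    exact h.filter_mono nhdsWithin_le_nhds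
  have hsubu : uIcc a b ⊆ interior I := by rw [uIcc_of_le hΓ.lt.le]; exact hΓ.subset
  have hcX : ContinuousOn X (interior I) := fun s hs => (hX s hs).continuousAt.continuousWithinAt
  have hcX' : ContinuousOn X' (interior I) := fun s hs => (hX' s hs).continuousAt.continuousWithinAt
  have hcform : ∀ g h : ℝ → V, ContinuousOn g (interior I) → ContinuousOn h (interior I) →
      ContinuousOn (fun s => M.form (g s) (h s)) (interior I) := fun g h hg hh =>
    contDiffOn_zero.1 (contDiffOn_form M (contDiffOn_zero.2 hg) (contDiffOn_zero.2 hh))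
  have hcf := hf.continuousOn
  have hcN := hF.smooth_N.continuousOn.mono (interior_subset (s := I))
  have hcB := hF.smooth_B.continuousOn.mono (interior_subset (s := I))
  have hcγ := hγ.smooth.continuousOn.mono (interior_subset (s := I))
  have hcT := (hγ.smooth_deriv hU).continuousOn.mono (interior_subset (s := I))
  have hf1 := hf.deriv_of_isOpen hJ (m := ∞) (by simp)
  have hcf1 := hf1.continuousOn
  have hcf2 := (hf1.deriv_of_isOpen hJ (m := ∞) (by simp)).continuousOn
  have hcτ := hτ.continuousOn
  have hcτ1 := (hτ.deriv_of_isOpen hJ (m := ∞) (by simp)).continuousOn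
  have hcfi : ContinuousOn (fun s => (f s)⁻¹) (interior I) := hcf.inv₀ fun s hs => (hf0 s hs).ne'
  have hi1 : IntervalIntegrable (fun s => f s ^ 3 * (M.form (X'' s)
      ((f s)⁻¹ ^ 2 • N s - M.curv • γ s) - 2 * M.curv * M.form (X' s) (derivWithin γ I s)))
      volume a b := by
    refine (ContinuousOn.mono ?_ hsubu).intervalIntegrable
    have h1 := hcform _ _ hX'' (((hcfi.pow 2).smul hcN).sub (hcγ.const_smul M.curv))
    have h2 := hcform _ _ hcX' hcT
    exact (hcf.pow 3).mul (h1.sub (continuousOn_const.mul h2))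
  have hi2 : IntervalIntegrable (fun s => ((deriv (deriv f) s - (f s)⁻¹ ^ 3 - f s * τ s ^ 2 +
      M.curv * f s) * M.form (X s) (N s) +
      (2 * deriv f s * τ s + f s * deriv τ s) * M.form (X s) (B s))) volume a b := by
    refine (ContinuousOn.mono ?_ hsubu).intervalIntegrable
    have h1 := hcform _ _ hcX hcN
    have h2 := hcform _ _ hcX hcB
    fun_prop
  have hint := intervalIntegral.integral_eq_sub_of_hasDerivAt
    (fun s hs => hΦ s (hsubu hs)) (hi1.sub hi2)
  rw [intervalIntegral.integral_sub hi1 hi2, ha, hb, sub_zero, sub_eq_zero] at hint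
  refine hE.congr_deriv ?_
  refine Eq.trans (intervalIntegral.integral_congr fun s hs => ?_)
    (hint.trans (intervalIntegral.integral_congr fun s hs => ?_))
  · simp only [hT s (hsubu hs)]; rfl
  · have h := eulerLagrange_eq hJ (K := M.curv) hf hτ hf0 hkf (hsubu hs)
    have h1 : Real.sqrt (k s) = (f s)⁻¹ := by simp [hfdef]
    have h0 := (hf0 s (hsubu hs)).ne'
    simp only [h.1, h.2, h1]
    field_simp

end SpaceFormModel

/-! ### Test variations and the Euler-Lagrange equations. -/

/-- A fundamental lemma of the calculus of variations, with bump functions as test functions. -/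
theorem eq_zero_of_integral_mul_contDiffBump_eq_zero {J : Set ℝ} (hJ : IsOpen J) {A : ℝ → ℝ}
    (hA : ContinuousOn A J)
    (h : ∀ (c : ℝ) (φ : ContDiffBump c), Icc (c - φ.rOut) (c + φ.rOut) ⊆ J →
      ∫ s in (c - φ.rOut)..(c + φ.rOut), A s * φ s = 0) {c : ℝ} (hc : c ∈ J) : A c = 0 := by
  by_contra hne
  -- Multiplying by A c makes the integrand positive near c whatever the sign of A c.
  have hev : ∀ᶠ x in 𝓝 c, x ∈ J ∧ 0 < A c * A x :=
    Filter.Eventually.and (hJ.mem_nhds hc) <|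
      ((hA.continuousAt (hJ.mem_nhds hc)).const_mul (A c)).eventually (lt_mem_nhds (mul_self_pos.2 hne))
  obtain ⟨r, hr, hball⟩ := Metric.nhds_basis_closedBall.mem_iff.1 hev
  rw [Real.closedBall_eq_Icc] at hball
  let φ : ContDiffBump c := ⟨r / 2, r, by positivity, by linarith⟩
  have hsub : Icc (c - φ.rOut) (c + φ.rOut) ⊆ J := fun x hx => (hball hx).1
  have hlt : c - φ.rOut < c + φ.rOut := by linarith [φ.rOut_pos]
  have hint : IntervalIntegrable (fun s => A c * A s * φ s) volume (c - φ.rOut) (c + φ.rOut) := by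
    refine ContinuousOn.intervalIntegrable ?_
    rw [uIcc_of_le hlt.le]
    exact (continuousOn_const.mul (hA.mono hsub)).mul φ.continuous.continuousOn
  have hpos := intervalIntegral.intervalIntegral_pos_of_pos_on hint (fun x hx =>
    mul_pos (hball (Ioo_subset_Icc_self hx)).2
      (φ.pos_of_mem_ball (by rwa [Real.ball_eq_Ioo]))) hlt
  simp only [mul_assoc, intervalIntegral.integral_const_mul, h c φ hsub, mul_zero] at hpos
  exact lt_irrefl _ hpos

theorem continuousOn_eulerLagrange {J : Set ℝ} (hJ : IsOpen J) {K : ℝ} {k τ : ℝ → ℝ}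
    (hk : ContDiffOn ℝ ∞ k J) (hτ : ContDiffOn ℝ ∞ τ J) (hk0 : ∀ s ∈ J, 0 < k s) :
    ContinuousOn (eulerLagrangeN K k τ) J ∧ ContinuousOn (eulerLagrangeB k τ) J := by
  have hne : ∀ s ∈ J, k s ≠ 0 := fun s hs => (hk0 s hs).ne'
  have hu : ContDiffOn ℝ ∞ (fun x => (k x)⁻¹) J := hk.inv hne
  have hu1 := hu.deriv_of_isOpen hJ (m := ∞) (by simp)
  have hu2 := (hu1.deriv_of_isOpen hJ (m := ∞) (by simp)).continuousOn
  have hc1 := hu1.continuousOn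
  have hc := hu.continuousOn
  have hq : ContDiffOn ℝ ∞ (fun x => τ x / k x) J := hτ.div hk hne
  refine ⟨?_, (hq.deriv_of_isOpen hJ (m := ∞) (by simp)).continuousOn⟩
  have hqc := hq.continuousOn
  unfold eulerLagrangeN
  fun_prop

namespace SpaceFormModel

variable {V : Type*} [NormedAddCommGroup V] [NormedSpace ℝ V] {M : SpaceFormModel V}
  {I : Set ℝ} {γ N B : ℝ → V} {k τ : ℝ → ℝ}

/-- The variation of `γ` in the direction of the tangent field `φ e`, brought back to the space
form by radial projection. -/
noncomputable def radialVariation (M : SpaceFormModel V) (γ e : ℝ → V) (φ : ℝ → ℝ) (t s : ℝ) : V :=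
  (Real.sqrt (1 + M.curv * (t * φ s) ^ 2))⁻¹ • (γ s + (t * φ s) • e s)

/-- The normalizing factor depends on t only through t², so it does not contribute at t = 0. -/
theorem hasDerivAt_radialVariation (γ e : ℝ → V) (φ : ℝ → ℝ) (s : ℝ) :
    HasDerivAt (fun t => M.radialVariation γ e φ t s) (φ s • e s) 0 := by
  have h1 : HasDerivAt (fun t : ℝ => t * φ s) (φ s) 0 := by
    simpa using (hasDerivAt_id (0 : ℝ)).mul_const (φ s)
  have h2 := ((((h1.pow 2).const_mul M.curv).const_add 1).sqrt (by simp)).inv (by simp)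
  have h3 := h2.smul ((h1.smul_const (e s)).const_add (γ s))
  refine h3.congr_deriv ?_
  simp

theorem isVariation_radialVariation (hM : M.IsSpaceForm) (hγ : M.IsUnitSpeedCurve I γ) {e : ℝ → V}
    (he : ContDiffOn ℝ ∞ e I) (het : ∀ s ∈ I, M.curv * M.form (γ s) (e s) = 0)
    (heu : ∀ s ∈ I, M.form (e s) (e s) = 1) {c : ℝ} (φ : ContDiffBump c)
    (hsub : Icc (c - φ.rOut) (c + φ.rOut) ⊆ interior I) :
    M.IsVariation I γ (c - φ.rOut) (c + φ.rOut) (1 / 2) (M.radialVariation γ e φ) := by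
  -- The critical case is K = -1, where 0 ≤ φ ≤ 1 and |t| < 1/2 keep (tφ)² below 1.
  have hpos : ∀ t ∈ Ioo (-(1 / 2) : ℝ) (1 / 2), ∀ s, 0 < 1 + M.curv * (t * φ s) ^ 2 := by
    intro t ht s
    have h1 : (t * φ s) ^ 2 < 1 := by
      have h0 := φ.nonneg (x := s)
      have h2 := φ.le_one (x := s)
      rw [sq_lt_one_iff_abs_lt_one, abs_mul, abs_of_nonneg h0]
      have : |t| < 1 / 2 := abs_lt.2 ht
      nlinarith [abs_nonneg t]
    have h3 := sq_nonneg (t * φ s)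
    rcases hM.curv_cases with h | h | h <;> rw [h] <;> linarith
  refine ⟨by norm_num, by linarith [φ.rOut_pos], hsub, ?_, ?_, ?_, ?_⟩
  · have hp : ContDiffOn ℝ ∞ (fun q : ℝ × ℝ => q.1 * φ q.2) (Ioo (-(1 / 2)) (1 / 2) ×ˢ I) :=
      contDiff_fst.contDiffOn.mul (φ.contDiff.comp contDiff_snd).contDiffOn
    have h2 : ∀ g : ℝ → V, ContDiffOn ℝ ∞ g I → ContDiffOn ℝ ∞ (fun q : ℝ × ℝ => g q.2)
        (Ioo (-(1 / 2)) (1 / 2) ×ˢ I) := fun g hg =>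
      hg.comp contDiff_snd.contDiffOn (fun q hq => hq.2)
    have h3 : ContDiffOn ℝ ∞ (fun q : ℝ × ℝ => 1 + M.curv * (q.1 * φ q.2) ^ 2)
        (Ioo (-(1 / 2)) (1 / 2) ×ˢ I) := contDiffOn_const.add (contDiffOn_const.mul (hp.pow 2))
    exact ((h3.sqrt fun q hq => (hpos q.1 hq.1 q.2).ne').inv fun q hq =>
      (Real.sqrt_pos.2 (hpos q.1 hq.1 q.2)).ne').smul ((h2 γ hγ.smooth).add (hp.smul (h2 e he)))
  · intro t ht s hs
    have hv : M.form ((t * φ s) • e s) ((t * φ s) • e s) = (t * φ s) ^ 2 := by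
      simp [heu s hs]; ring
    have h := hM.normalize_mem (γ s) (hγ.mem s hs) ((t * φ s) • e s)
      (by simp only [map_smul, smul_eq_mul]; linear_combination (t * φ s) * het s hs)
    rw [hv] at h
    exact h (hpos t ht s)
  · intro s hs
    simp [radialVariation]
  · intro t ht s hs
    have : φ s = 0 := φ.zero_of_le_dist (by
      by_contra hlt
      refine hs.2 (Ioo_subset_Icc_self ?_)
      rw [← Real.ball_eq_Ioo]
      exact not_le.1 hlt)
    simp [radialVariation, this]

variable [FiniteDimensional ℝ V]

/-- The Euler-Lagrange equations of the `1/2`-bienergy. -/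
theorem IsFrenetFrame.isPBiharmonic_iff (hF : M.IsFrenetFrame I γ k τ N B)
    (hγ : M.IsUnitSpeedCurve I γ) (hM : M.IsSpaceForm) (hU : UniqueDiffOn ℝ I) :
    M.IsPBiharmonic (1 / 2) I γ ↔
      ∀ s ∈ interior I, eulerLagrangeN M.curv k τ s = 0 ∧ eulerLagrangeB k τ s = 0 := by
  have hkp : ∀ s ∈ interior I, 0 < k s := fun s hs => hF.k_pos s (interior_subset hs)
  constructor
  · intro h
    have hk := (hF.smooth_k hγ hM hU).mono interior_subset
    have hτ := (hF.smooth_τ hγ hM hU).mono interior_subset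
    obtain ⟨hcN, hcB⟩ := continuousOn_eulerLagrange (K := M.curv) isOpen_interior hk hτ hkp
    have hck := hk.continuousOn.sqrt
    -- The variation field is φe; taking e = N or e = B isolates one of the two equations by
    -- orthonormality.
    have key : ∀ e : ℝ → V, ContDiffOn ℝ ∞ e I → (∀ s ∈ I, M.curv * M.form (γ s) (e s) = 0) →
        (∀ s ∈ I, M.form (e s) (e s) = 1) → ∀ (c : ℝ) (φ : ContDiffBump c),
        Icc (c - φ.rOut) (c + φ.rOut) ⊆ interior I →
        (∫ s in (c - φ.rOut)..(c + φ.rOut),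
          (Real.sqrt (k s) ^ 3 / 4 * eulerLagrangeN M.curv k τ s * M.form (e s) (N s) +
          Real.sqrt (k s) * eulerLagrangeB k τ s * M.form (e s) (B s)) * φ s) = 0 := by
      intro e he het heu c φ hsub
      have hΓ := isVariation_radialVariation hM hγ he het heu φ hsub
      obtain ⟨X, hX, -, hE⟩ := hΓ.exists_firstVariation hU hM hγ hF
      rw [← hE.unique (h _ _ _ _ hΓ)]
      refine intervalIntegral.integral_congr fun s hs => ?_
      rw [uIcc_of_le hΓ.lt.le] at hs
      simp only [(hX s (hsub hs)).unique (hasDerivAt_radialVariation γ e φ s), map_smul,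
        LinearMap.smul_apply, smul_eq_mul]
      ring
    intro s hs
    have hsk := Real.sqrt_pos.2 (hkp s hs)
    constructor
    · have h1 := eq_zero_of_integral_mul_contDiffBump_eq_zero isOpen_interior
        (A := fun s => Real.sqrt (k s) ^ 3 / 4 * eulerLagrangeN M.curv k τ s)
        (((hck.pow 3).div_const 4).mul hcN) (fun c φ hsub => by
          rw [← key N hF.smooth_N (fun s hs => hF.form_N hγ hM hs) hF.unit_N c φ hsub]
          refine intervalIntegral.integral_congr fun s hs => ?_
          rw [uIcc_of_le (by linarith [φ.rOut_pos])] at hs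
          have hsI := interior_subset (hsub hs)
          simp [hF.unit_N s hsI, hF.orth_NB s hsI]) hs
      exact (mul_eq_zero.1 h1).resolve_left (by positivity)
    · have h1 := eq_zero_of_integral_mul_contDiffBump_eq_zero isOpen_interior
        (A := fun s => Real.sqrt (k s) * eulerLagrangeB k τ s)
        (hck.mul hcB) (fun c φ hsub => by
          rw [← key B hF.smooth_B (fun s hs => hF.form_B hγ hM hs) hF.unit_B c φ hsub]
          refine intervalIntegral.integral_congr fun s hs => ?_
          rw [uIcc_of_le (by linarith [φ.rOut_pos])] at hs
          have hsI := interior_subset (hsub hs)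
          simp [hF.unit_B s hsI, hF.orth_NB s hsI, hM.symm (B s)]) hs
      exact (mul_eq_zero.1 h1).resolve_left hsk.ne'
  · intro h a b ε Γ hΓ
    obtain ⟨X, -, -, hE⟩ := hΓ.exists_firstVariation hU hM hγ hF
    refine hE.congr_deriv ?_
    rw [← intervalIntegral.integral_zero (a := a) (b := b) (μ := volume)]
    refine intervalIntegral.integral_congr fun s hs => ?_
    rw [uIcc_of_le hΓ.lt.le] at hs
    simp [h s (hΓ.subset hs)]

end SpaceFormModel

/-! ### Solving the Euler-Lagrange equations for the radius of curvature. -/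

theorem exists_eq_const_of_hasDerivAt_zero {J : Set ℝ} (hJ : IsOpen J) (hJc : IsPreconnected J)
    {g : ℝ → ℝ} (hg : ∀ s ∈ J, HasDerivAt g 0 s) : ∃ c, ∀ s ∈ J, g s = c :=
  hJ.exists_is_const_of_deriv_eq_zero hJc
    (fun s hs => (hg s hs).differentiableAt.differentiableWithinAt) (fun s hs => (hg s hs).deriv)

/-- The radius of curvature `u` of a solution of the Euler-Lagrange equations with torsion `b / u`,
together with its derivative `u'`; the constant `C` is that of the first integral. -/
structure IsCurvatureRadius (K b C : ℝ) (J : Set ℝ) (u u' : ℝ → ℝ) : Prop where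
  pos : ∀ s ∈ J, 0 < u s
  hasDerivAt : ∀ s ∈ J, HasDerivAt u (u' s) s
  hasDerivAt' : ∀ s ∈ J, HasDerivAt u' (2 * C - 4 * K * u s) s
  first_integral : ∀ s ∈ J, u' s ^ 2 = 4 * C * u s - 4 * (1 + b ^ 2) - 4 * K * u s ^ 2

theorem exists_isCurvatureRadius {J : Set ℝ} (hJ : IsOpen J) (hJc : IsPreconnected J) {K : ℝ}
    {k τ : ℝ → ℝ} (hk : ContDiffOn ℝ ∞ k J) (hτ : ContDiffOn ℝ ∞ τ J) (hk0 : ∀ s ∈ J, 0 < k s)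
    (hN : ∀ s ∈ J, eulerLagrangeN K k τ s = 0) (hB : ∀ s ∈ J, eulerLagrangeB k τ s = 0) :
    ∃ b C, (∀ s ∈ J, τ s = b * k s) ∧
      ∃ u', IsCurvatureRadius K b C J (fun s => (k s)⁻¹) u' := by
  have hne : ∀ s ∈ J, k s ≠ 0 := fun s hs => (hk0 s hs).ne'
  obtain ⟨b, hb⟩ := exists_eq_const_of_hasDerivAt_zero hJ hJc (g := fun x => τ x / k x)
    (fun s hs => ((hτ.div hk hne).hasDerivAt_deriv hJ hs).congr_deriv (hB s hs))
  have hu : ContDiffOn ℝ ∞ (fun x => (k x)⁻¹) J := hk.inv hne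
  have hu1 := fun s hs => hu.hasDerivAt_deriv hJ (s := s) hs
  have hu2 := fun s hs =>
    (hu.deriv_of_isOpen hJ (m := ∞) (by simp)).hasDerivAt_deriv hJ (s := s) hs
  have hup : ∀ s ∈ J, 0 < (k s)⁻¹ := fun s hs => inv_pos.2 (hk0 s hs)
  unfold eulerLagrangeN at hN
  set u : ℝ → ℝ := fun x => (k x)⁻¹ with hudef
  have hN' : ∀ s ∈ J, 2 * u s * deriv (deriv u) s - deriv u s ^ 2 - 4 * (1 + b ^ 2) +
      4 * K * u s ^ 2 = 0 := by
    intro s hs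
    have h := hN s hs
    simp only [hb s hs] at h
    exact h
  -- The numerator of the derivative of this quotient is 4u' times the left side of `hN'`.
  obtain ⟨C, hC⟩ := exists_eq_const_of_hasDerivAt_zero hJ hJc
    (g := fun s => (deriv u s ^ 2 + 4 * (1 + b ^ 2) + 4 * K * u s ^ 2) / (4 * u s)) (by
      intro s hs
      have h0 : u s ≠ 0 := (hup s hs).ne'
      refine (((((hu2 s hs).pow 2).add_const (4 * (1 + b ^ 2))).add
        (((hu1 s hs).pow 2).const_mul (4 * K))).div ((hu1 s hs).const_mul 4)
        (by positivity)).congr_deriv ?_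
      simp only [Pi.add_apply, Pi.pow_apply]
      rw [div_eq_zero_iff]
      left
      push_cast
      linear_combination (4 * deriv u s) * hN' s hs)
  have hC' : ∀ s ∈ J, deriv u s ^ 2 + 4 * (1 + b ^ 2) + 4 * K * u s ^ 2 = 4 * C * u s := by
    intro s hs
    have h := hC s hs
    have h0 : u s ≠ 0 := (hup s hs).ne'
    rw [div_eq_iff (by positivity)] at h
    linarith
  refine ⟨b, C, fun s hs => ?_, deriv u, hup, hu1, fun s hs => (hu2 s hs).congr_deriv ?_,
    fun s hs => by linarith [hC' s hs]⟩
  · rw [← hb s hs, div_mul_cancel₀ _ (hne s hs)]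
  -- Adding the equation and its first integral gives 2uu'' = 2u(2C - 4Ku), and u ≠ 0 can be
  -- cancelled.
  · refine mul_left_cancel₀ (mul_ne_zero two_ne_zero (hup s hs).ne') ?_
    change 2 * u s * _ = 2 * u s * _
    linear_combination hN' s hs + hC' s hs

/-- This serves the converse: the explicit radii are differentiable on all of ℝ, while k agrees with
1/u only on J. -/
theorem eulerLagrange_eq_zero_of_radius {J : Set ℝ} (hJ : IsOpen J) {K b : ℝ} {k τ u u' u'' : ℝ → ℝ}
    (hk0 : ∀ s ∈ J, k s ≠ 0) (hk : ∀ s ∈ J, (k s)⁻¹ = u s) (hτ : ∀ s ∈ J, τ s = b * k s)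
    (hu : ∀ s, HasDerivAt u (u' s) s) (hu' : ∀ s, HasDerivAt u' (u'' s) s)
    (h : ∀ s, 2 * u s * u'' s - u' s ^ 2 = 4 * (1 + b ^ 2) - 4 * K * u s ^ 2) :
    ∀ s ∈ J, eulerLagrangeN K k τ s = 0 ∧ eulerLagrangeB k τ s = 0 := by
  have hd : ∀ s ∈ J, HasDerivAt (fun x => (k x)⁻¹) (u' s) s := fun s hs =>
    (hu s).congr_of_eventuallyEq (by filter_upwards [hJ.mem_nhds hs] with x hx using hk x hx)
  intro s hs
  have hd2 : HasDerivAt (deriv fun x => (k x)⁻¹) (u'' s) s :=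
    (hu' s).congr_of_eventuallyEq (by
      filter_upwards [hJ.mem_nhds hs] with x hx using (hd x hx).deriv)
  have hq : ∀ x ∈ J, τ x / k x = b := fun x hx => by
    rw [hτ x hx, mul_div_cancel_right₀ _ (hk0 x hx)]
  constructor
  · rw [eulerLagrangeN, hd2.deriv, (hd s hs).deriv, hq s hs, hk s hs]
    linear_combination h s
  · have : HasDerivAt (fun x => τ x / k x) 0 s :=
      (hasDerivAt_const s b).congr_of_eventuallyEq (by
        filter_upwards [hJ.mem_nhds hs] with x hx using hq x hx)
    exact this.deriv

/-- This reduces non-constancy of k to the fact that u' and u'' have no common zero, which is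
visible from the explicit formulas. -/
theorem exists_deriv_eq_zero_of_const {J : Set ℝ} (hJ : IsOpen J) (hne : J.Nonempty)
    {k u u' u'' : ℝ → ℝ} (hk : ∀ s ∈ J, (k s)⁻¹ = u s)
    (hu : ∀ s, HasDerivAt u (u' s) s) (hu' : ∀ s, HasDerivAt u' (u'' s) s)
    (hc : ∀ s ∈ J, ∀ t ∈ J, k s = k t) : ∃ s, u' s = 0 ∧ u'' s = 0 := by
  obtain ⟨s, hs⟩ := hne
  have h1 : ∀ x ∈ J, u' x = 0 := fun x hx =>
    (hu x).unique ((hasDerivAt_const x (u s)).congr_of_eventuallyEq (by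
      filter_upwards [hJ.mem_nhds hx] with y hy
      rw [← hk y hy, ← hk s hs, hc y hy s hs]))
  exact ⟨s, h1 s hs, (hu' s).unique ((hasDerivAt_const s (0 : ℝ)).congr_of_eventuallyEq (by
      filter_upwards [hJ.mem_nhds hs] with y hy using h1 y hy))⟩

namespace IsCurvatureRadius

variable {b C : ℝ} {J : Set ℝ} {u u' : ℝ → ℝ}

/-- Here u'' = 2C, so u' = 2C(s - d), and the first integral then yields u without a second
integration. -/
theorem flat_eq (h : IsCurvatureRadius 0 b C J u u') (hJ : IsOpen J) (hJc : IsPreconnected J)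
    (hne : J.Nonempty) :
    0 < C ∧ ∃ d, ∀ s ∈ J, u s = (C ^ 2 * (s - d) ^ 2 + 1 + b ^ 2) / C := by
  obtain ⟨x, hx⟩ := hne
  have hC : 0 < C := by
    have h1 := h.first_integral x hx
    have h2 := h.pos x hx
    have h3 : 0 < C * u x := by nlinarith [sq_nonneg (u' x), sq_nonneg b]
    exact (pos_iff_pos_of_mul_pos h3).2 h2
  obtain ⟨c, hc⟩ := exists_eq_const_of_hasDerivAt_zero hJ hJc (g := fun s => u' s - 2 * C * s)
    (fun s hs => ((h.hasDerivAt' s hs).sub ((hasDerivAt_id s).const_mul (2 * C))).congr_deriv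
      (by ring))
  refine ⟨hC, -c / (2 * C), fun s hs => ?_⟩
  have h1 : u' s = 2 * C * (s - -c / (2 * C)) := by
    have := hc s hs
    field_simp
    linarith
  have h2 := h.first_integral s hs
  rw [h1] at h2
  rw [eq_div_iff hC.ne']
  linarith

/-- The vector (u - C/2, u'/2) rotates with angular speed 2. Undoing the rotation leaves the
constants p and q, and the first integral fixes its length. -/
theorem spherical_eq (h : IsCurvatureRadius 1 b C J u u') (hJ : IsOpen J) (hJc : IsPreconnected J)
    (hne : J.Nonempty) :
    ∃ p q : ℝ, 4 * (q ^ 2 + p ^ 2) = C ^ 2 - 4 - 4 * b ^ 2 ∧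
      ∀ s ∈ J, u s = C / 2 + (p * Real.cos (2 * s) + q * Real.sin (2 * s)) := by
  have hl : ∀ s : ℝ, HasDerivAt (fun s : ℝ => 2 * s) 2 s := fun s => by
    simpa using (hasDerivAt_id s).const_mul 2
  have hcs := fun s => (hl s).cos
  have hsn := fun s => (hl s).sin
  obtain ⟨p, hp⟩ := exists_eq_const_of_hasDerivAt_zero hJ hJc
    (g := fun s => (u s - C / 2) * Real.cos (2 * s) - u' s / 2 * Real.sin (2 * s))
    (fun s hs => ((((h.hasDerivAt s hs).sub_const (C / 2)).mul (hcs s)).sub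
      (((h.hasDerivAt' s hs).div_const 2).mul (hsn s))).congr_deriv (by ring))
  obtain ⟨q, hq⟩ := exists_eq_const_of_hasDerivAt_zero hJ hJc
    (g := fun s => (u s - C / 2) * Real.sin (2 * s) + u' s / 2 * Real.cos (2 * s))
    (fun s hs => ((((h.hasDerivAt s hs).sub_const (C / 2)).mul (hsn s)).add
      (((h.hasDerivAt' s hs).div_const 2).mul (hcs s))).congr_deriv (by ring))
  refine ⟨p, q, ?_, fun s hs => ?_⟩
  · obtain ⟨x, hx⟩ := hne
    rw [← hp x hx, ← hq x hx]
    linear_combination (4 * (u x - C / 2) ^ 2 + u' x ^ 2) * Real.sin_sq_add_cos_sq (2 * x) +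
      h.first_integral x hx
  · rw [← hp s hs, ← hq s hs]
    linear_combination -(u s - C / 2) * Real.sin_sq_add_cos_sq (2 * s)

/-- The mode E = 2u + C - u' is a multiple of e^(-2s). The first integral is equivalent to 4uE = (E
- C)² + 4 + 4b², so this one mode determines u. -/
theorem hyperbolic_eq (h : IsCurvatureRadius (-1) b C J u u') (hJ : IsOpen J)
    (hJc : IsPreconnected J) (hne : J.Nonempty) :
    ∃ d, ∀ s ∈ J, u s = ((-C + Real.exp (-2 * (d + s))) ^ 2 + 4 + 4 * b ^ 2) /
      (4 * Real.exp (-2 * (d + s))) := by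
  have hl : ∀ c s : ℝ, HasDerivAt (fun s : ℝ => Real.exp (c * s)) (Real.exp (c * s) * c) s :=
    fun c s => by simpa using ((hasDerivAt_id s).const_mul c).exp
  obtain ⟨β, hβ⟩ := exists_eq_const_of_hasDerivAt_zero hJ hJc
    (g := fun s => (2 * (u s + C / 2) - u' s) * Real.exp (2 * s))
    (fun s hs => (((((h.hasDerivAt s hs).add_const (C / 2)).const_mul 2).sub
      (h.hasDerivAt' s hs)).mul (hl 2 s)).congr_deriv (by simp only [Pi.sub_apply]; ring))
  have hee : ∀ s : ℝ, Real.exp (-2 * s) * Real.exp (2 * s) = 1 := fun s => by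
    rw [← Real.exp_add]; simp
  have hβ0 : 0 < β := by
    obtain ⟨x, hx⟩ := hne
    rw [← hβ x hx]
    have h1 := h.first_integral x hx
    have h2 := h.pos x hx
    refine mul_pos ?_ (Real.exp_pos _)
    -- Both factors are positive: their product is, and their sum 2(u + (C + u)) is as well, because
    -- the first integral forces C + u > 0.
    have h3 : (2 * (u x + C / 2) + u' x) * (2 * (u x + C / 2) - u' x) =
        C ^ 2 + 4 * (1 + b ^ 2) := by linear_combination -h1
    have h4 : 0 < (C + u x) * u x := by nlinarith [sq_nonneg (u' x), sq_nonneg b]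
    have h5 := (pos_iff_pos_of_mul_pos h4).2 h2
    by_contra hle
    rw [not_lt] at hle
    nlinarith [mul_nonpos_of_nonneg_of_nonpos (by linarith : 0 ≤ 2 * (u x + C / 2) + u' x) hle,
      sq_nonneg b, sq_nonneg C]
  -- The shift is chosen so that e^(-2(d+s)) = βe^(-2s), which is possible because β > 0.
  refine ⟨-Real.log β / 2, fun s hs => ?_⟩
  have hE : Real.exp (-2 * (-Real.log β / 2 + s)) = β * Real.exp (-2 * s) := by
    rw [show -2 * (-Real.log β / 2 + s) = Real.log β + -2 * s by ring, Real.exp_add,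
      Real.exp_log hβ0]
  have hE' : β * Real.exp (-2 * s) = 2 * (u s + C / 2) - u' s := by
    rw [← hβ s hs, mul_assoc, mul_comm (Real.exp _), hee, mul_one]
  have hpos : 0 < β * Real.exp (-2 * s) := mul_pos hβ0 (Real.exp_pos _)
  rw [hE, eq_div_iff (by positivity), hE']
  linear_combination -h.first_integral s hs

end IsCurvatureRadius

/-! ### The curvature formulas on I, endpoints included. -/

section Classification

variable {I : Set ℝ} {k τ : ℝ → ℝ}

/-- A formula for the radius of curvature on the interior extends by continuity to the endpoints. -/
theorem extend_inv_eq (hI : I.OrdConnected) (hI' : (interior I).Nonempty) (hk : ContinuousOn k I)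
    (hk0 : ∀ s ∈ I, 0 < k s) {u : ℝ → ℝ} (hu : Continuous u)
    (h : ∀ s ∈ interior I, (k s)⁻¹ = u s) : ∀ s ∈ I, k s = (u s)⁻¹ := by
  have h1 : EqOn (fun s => (k s)⁻¹) u I := EqOn.of_subset_closure h
    (hk.inv₀ fun s hs => (hk0 s hs).ne') hu.continuousOn interior_subset
    (SpaceFormModel.subset_closure_interior_of_ordConnected hI hI')
  intro s hs
  rw [← h1 hs, inv_inv]

theorem exists_curvature_ne_of_radius {u u' u'' : ℝ → ℝ} (hI' : (interior I).Nonempty)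
    (hk : ∀ s ∈ I, (k s)⁻¹ = u s) (hu : ∀ s, HasDerivAt u (u' s) s)
    (hu' : ∀ s, HasDerivAt u' (u'' s) s) (h : ∀ s, ¬(u' s = 0 ∧ u'' s = 0)) :
    ∃ s ∈ I, ∃ t ∈ I, k s ≠ k t := by
  by_contra! hc
  obtain ⟨s, hs⟩ := exists_deriv_eq_zero_of_const isOpen_interior hI'
    (fun s hs => hk s (interior_subset hs)) hu hu'
    (fun s hs t ht => hc s (interior_subset hs) t (interior_subset ht))
  exact h s hs

variable (hI : I.OrdConnected) (hI' : (interior I).Nonempty) (hk : ContDiffOn ℝ ∞ k I)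
  (hτ : ContDiffOn ℝ ∞ τ I) (hk0 : ∀ s ∈ I, 0 < k s)
include hI hI' hk hτ hk0

theorem exists_isCurvatureRadius_interior {K : ℝ}
    (h : ∀ s ∈ interior I, eulerLagrangeN K k τ s = 0 ∧ eulerLagrangeB k τ s = 0) :
    ∃ b C, (∀ s ∈ I, τ s = b * k s) ∧
      ∃ u', IsCurvatureRadius K b C (interior I) (fun s => (k s)⁻¹) u' := by
  obtain ⟨b, C, hb, hu⟩ := exists_isCurvatureRadius isOpen_interior hI.interior.isPreconnected
    (hk.mono interior_subset) (hτ.mono interior_subset)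
    (fun s hs => hk0 s (interior_subset hs)) (fun s hs => (h s hs).1) (fun s hs => (h s hs).2)
  exact ⟨b, C, EqOn.of_subset_closure hb hτ.continuousOn (continuousOn_const.mul hk.continuousOn)
    interior_subset (SpaceFormModel.subset_closure_interior_of_ordConnected hI hI'), hu⟩

theorem flat_classification :
    ((∀ s ∈ interior I, eulerLagrangeN 0 k τ s = 0 ∧ eulerLagrangeB k τ s = 0) ∧
      ∃ s ∈ I, ∃ t ∈ I, k s ≠ k t) ↔
    ∃ b₁ b₄ b₅ : ℝ, ∀ s ∈ I,
      k s = b₄ / (b₄ ^ 2 * (s - b₅) ^ 2 + 1 + b₁ ^ 2) ∧ τ s = b₁ * k s := by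
  constructor
  · rintro ⟨h, -⟩
    obtain ⟨b, C, hb, u', hu⟩ := exists_isCurvatureRadius_interior hI hI' hk hτ hk0 h
    obtain ⟨-, d, hd⟩ := hu.flat_eq isOpen_interior hI.interior.isPreconnected hI'
    refine ⟨b, C, d, fun s hs => ⟨?_, hb s hs⟩⟩
    rw [extend_inv_eq hI hI' hk.continuousOn hk0 (by fun_prop) hd s hs, inv_div]
  · rintro ⟨b, c, d, h⟩
    have hc : c ≠ 0 := by
      rintro rfl
      obtain ⟨s, hs⟩ := hI'
      have h1 := hk0 s (interior_subset hs)
      rw [(h s (interior_subset hs)).1] at h1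
      simp at h1
    have hinv : ∀ s ∈ I, (k s)⁻¹ = (c ^ 2 * (s - d) ^ 2 + 1 + b ^ 2) / c := fun s hs => by
      rw [(h s hs).1, inv_div]
    have hl : ∀ s : ℝ, HasDerivAt (fun s => s - d) 1 s := fun s => (hasDerivAt_id s).sub_const d
    have hu : ∀ s, HasDerivAt (fun s => (c ^ 2 * (s - d) ^ 2 + 1 + b ^ 2) / c)
        (2 * c * (s - d)) s := fun s =>
      ((((((hl s).pow 2).const_mul (c ^ 2)).add_const 1).add_const (b ^ 2)).div_const c).congr_deriv
        (by push_cast; field_simp)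
    have hu' : ∀ s, HasDerivAt (fun s => 2 * c * (s - d)) (2 * c) s := fun s =>
      ((hl s).const_mul (2 * c)).congr_deriv (by ring)
    refine ⟨eulerLagrange_eq_zero_of_radius isOpen_interior
      (fun s hs => (hk0 s (interior_subset hs)).ne') (fun s hs => hinv s (interior_subset hs))
      (fun s hs => (h s (interior_subset hs)).2) hu hu' fun s => ?_,
      exists_curvature_ne_of_radius hI' hinv hu hu' fun s hs => ?_⟩
    · field_simp; ring
    · simpa [hc] using hs.2

theorem spherical_classification :
    ((∀ s ∈ interior I, eulerLagrangeN 1 k τ s = 0 ∧ eulerLagrangeB k τ s = 0) ∧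
      ∃ s ∈ I, ∃ t ∈ I, k s ≠ k t) ↔
    ∃ b₁ b₂ b₃ : ℝ, 4 + 4 * b₁ ^ 2 < b₂ ^ 2 ∧ ∀ s ∈ I,
      k s = 2 / (b₂ + Real.sqrt (b₂ ^ 2 - 4 - 4 * b₁ ^ 2) * Real.sin (2 * (s + b₃))) ∧
      τ s = b₁ * k s := by
  constructor
  · rintro ⟨h, x, hx, y, hy, hxy⟩
    obtain ⟨b, C, hb, u', hu⟩ := exists_isCurvatureRadius_interior hI hI' hk hτ hk0 h
    obtain ⟨p, q, hpq, hu⟩ := hu.spherical_eq isOpen_interior hI.interior.isPreconnected hI'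
    have hkI := extend_inv_eq hI hI' hk.continuousOn hk0 (by fun_prop) hu
    -- Polar coordinates of q + ip turn p cos 2s + q sin 2s into ‖z‖ sin(2s + arg z), whence the
    -- phase b₃ = arg z / 2.
    set z : ℂ := ⟨q, p⟩ with hz
    have hnorm : 4 * ‖z‖ ^ 2 = C ^ 2 - 4 - 4 * b ^ 2 := by
      rw [← hpq, Complex.sq_norm, Complex.normSq_apply]; ring
    have hsqrt : Real.sqrt (C ^ 2 - 4 - 4 * b ^ 2) = 2 * ‖z‖ := by
      rw [← hnorm, show 4 * ‖z‖ ^ 2 = (2 * ‖z‖) ^ 2 by ring, Real.sqrt_sq (by positivity)]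
    -- Non-constancy of k enters here: a zero amplitude would make k constant. It gives the strict
    -- inequality for b₂.
    have hzpos : 0 < ‖z‖ := by
      refine norm_pos_iff.2 fun h0 => hxy ?_
      have hq0 : q = 0 := congrArg Complex.re h0
      have hp0 : p = 0 := congrArg Complex.im h0
      rw [hkI x hx, hkI y hy, hp0, hq0]
      simp
    refine ⟨b, C, z.arg / 2, by nlinarith, fun s hs => ⟨?_, hb s hs⟩⟩
    have h1 : ‖z‖ * Real.cos z.arg = q := Complex.norm_mul_cos_arg z
    have h2 : ‖z‖ * Real.sin z.arg = p := Complex.norm_mul_sin_arg z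
    rw [hkI s hs, hsqrt, show 2 * (s + z.arg / 2) = 2 * s + z.arg by ring, Real.sin_add, ← h1, ← h2,
      ← inv_div _ (2 : ℝ)]
    congr 1
    ring
  · rintro ⟨b, c, d, hbc, h⟩
    set A := Real.sqrt (c ^ 2 - 4 - 4 * b ^ 2) with hA
    have hA2 : A ^ 2 = c ^ 2 - 4 - 4 * b ^ 2 := Real.sq_sqrt (by linarith)
    have hA0 : 0 < A := Real.sqrt_pos.2 (by linarith)
    have hinv : ∀ s ∈ I, (k s)⁻¹ = (c + A * Real.sin (2 * (s + d))) / 2 := fun s hs => by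
      rw [(h s hs).1, inv_div]
    have hl : ∀ s : ℝ, HasDerivAt (fun s => 2 * (s + d)) 2 s := fun s => by
      simpa using ((hasDerivAt_id s).add_const d).const_mul 2
    have hu : ∀ s, HasDerivAt (fun s => (c + A * Real.sin (2 * (s + d))) / 2)
        (A * Real.cos (2 * (s + d))) s := fun s =>
      ((((hl s).sin.const_mul A).const_add c).div_const 2).congr_deriv (by ring)
    have hu' : ∀ s, HasDerivAt (fun s => A * Real.cos (2 * (s + d)))
        (-2 * A * Real.sin (2 * (s + d))) s := fun s =>
      ((hl s).cos.const_mul A).congr_deriv (by ring)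
    refine ⟨eulerLagrange_eq_zero_of_radius isOpen_interior
      (fun s hs => (hk0 s (interior_subset hs)).ne') (fun s hs => hinv s (interior_subset hs))
      (fun s hs => (h s (interior_subset hs)).2) hu hu' fun s => ?_,
      exists_curvature_ne_of_radius hI' hinv hu hu' fun s hs => ?_⟩
    · linear_combination -A ^ 2 * Real.sin_sq_add_cos_sq (2 * (s + d)) - hA2
    · have h1 : Real.cos (2 * (s + d)) = 0 := (mul_eq_zero.1 hs.1).resolve_left hA0.ne'
      have h2 : Real.sin (2 * (s + d)) = 0 := (mul_eq_zero.1 hs.2).resolve_left (by simp [hA0.ne'])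
      have h3 := Real.sin_sq_add_cos_sq (2 * (s + d))
      rw [h1, h2] at h3
      norm_num at h3

theorem hyperbolic_classification :
    ((∀ s ∈ interior I, eulerLagrangeN (-1) k τ s = 0 ∧ eulerLagrangeB k τ s = 0) ∧
      ∃ s ∈ I, ∃ t ∈ I, k s ≠ k t) ↔
    ∃ b₁ b₆ b₇ : ℝ, ∀ s ∈ I,
      k s = 4 * Real.exp (-2 * (b₇ + s)) /
        ((b₆ + Real.exp (-2 * (b₇ + s))) ^ 2 + 4 + 4 * b₁ ^ 2) ∧ τ s = b₁ * k s := by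
  constructor
  · rintro ⟨h, -⟩
    obtain ⟨b, C, hb, u', hu⟩ := exists_isCurvatureRadius_interior hI hI' hk hτ hk0 h
    obtain ⟨d, hd⟩ := hu.hyperbolic_eq isOpen_interior hI.interior.isPreconnected hI'
    refine ⟨b, -C, d, fun s hs => ⟨?_, hb s hs⟩⟩
    rw [extend_inv_eq hI hI' hk.continuousOn hk0 ?_ hd s hs, inv_div]
    exact Continuous.div (by fun_prop) (by fun_prop) fun s => by positivity
  · rintro ⟨b, c, d, h⟩
    -- Expanding the square writes 1/k as a combination of exponentials and a constant; m > 0 later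
    -- makes u'' > 0.
    set m := (c ^ 2 + 4 + 4 * b ^ 2) / 4 with hm
    have hee : ∀ s : ℝ, Real.exp (2 * (d + s)) * Real.exp (-2 * (d + s)) = 1 := fun s => by
      rw [← Real.exp_add]; simp
    have hinv : ∀ s ∈ I, (k s)⁻¹ =
        m * Real.exp (2 * (d + s)) + c / 2 + Real.exp (-2 * (d + s)) / 4 := fun s hs => by
      rw [(h s hs).1, inv_div, div_eq_iff (by positivity), hm]
      linear_combination -(c ^ 2 + 4 + 4 * b ^ 2) * hee s
    have hl : ∀ r s : ℝ, HasDerivAt (fun s => Real.exp (r * (d + s)))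
        (Real.exp (r * (d + s)) * r) s := fun r s => by
      simpa using (((hasDerivAt_id s).const_add d).const_mul r).exp
    have hu : ∀ s, HasDerivAt
        (fun s => m * Real.exp (2 * (d + s)) + c / 2 + Real.exp (-2 * (d + s)) / 4)
        (2 * m * Real.exp (2 * (d + s)) - Real.exp (-2 * (d + s)) / 2) s := fun s =>
      ((((hl 2 s).const_mul m).add_const (c / 2)).add ((hl (-2) s).div_const 4)).congr_deriv
        (by ring)
    have hu' : ∀ s, HasDerivAt
        (fun s => 2 * m * Real.exp (2 * (d + s)) - Real.exp (-2 * (d + s)) / 2)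
        (4 * m * Real.exp (2 * (d + s)) + Real.exp (-2 * (d + s))) s := fun s =>
      (((hl 2 s).const_mul (2 * m)).sub ((hl (-2) s).div_const 2)).congr_deriv (by ring)
    refine ⟨eulerLagrange_eq_zero_of_radius isOpen_interior
      (fun s hs => (hk0 s (interior_subset hs)).ne') (fun s hs => hinv s (interior_subset hs))
      (fun s hs => (h s (interior_subset hs)).2) hu hu' fun s => ?_,
      exists_curvature_ne_of_radius hI' hinv hu hu' fun s hs => ?_⟩
    · linear_combination 4 * m * hee s + 4 * hm
    · have : 0 < 4 * m * Real.exp (2 * (d + s)) + Real.exp (-2 * (d + s)) := by positivity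
      exact this.ne' hs.2

end Classification

/-! ### Existence of the Frenet frame. -/

namespace SpaceFormModel

variable {V : Type*} [NormedAddCommGroup V] [NormedSpace ℝ V] [FiniteDimensional ℝ V]
  {M : SpaceFormModel V} {I : Set ℝ} {γ N B : ℝ → V} {k τ : ℝ → ℝ}

/-- A unit speed curve with nowhere vanishing tension field has a smooth Frenet frame. -/
theorem IsUnitSpeedCurve.exists_isFrenetFrame (hγ : M.IsUnitSpeedCurve I γ) (hM : M.IsSpaceForm)
    (hU : UniqueDiffOn ℝ I) (h0 : ∀ s ∈ I, M.tension I γ s ≠ 0) :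
    ∃ (k τ : ℝ → ℝ) (N B : ℝ → V), M.IsFrenetFrame I γ k τ N B := by
  obtain ⟨cr, hcr, hprop⟩ := hM.exists_cross
  set T := derivWithin γ I with hTdef
  have hT : ContDiffOn ℝ ∞ T I := hγ.smooth_deriv hU
  have hten : ContDiffOn ℝ ∞ (M.tension I γ) I := by
    refine ((hT.derivWithin hU (m := ∞) (by simp)).add
      (hγ.smooth.const_smul M.curv)).congr fun s hs => ?_
    simp [hTdef, hγ.deriv_tangent hM hU hs]
  have htγ : ∀ s ∈ I, M.curv * M.form (γ s) (M.tension I γ s) = 0 := fun s hs =>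
    curv_mul_form_tangentProj hM (hγ.mem s hs) _
  have hTγ : ∀ s ∈ I, M.curv * M.form (γ s) (T s) = 0 := fun s hs => hγ.form_tangent hM hU hs
  have htT : ∀ s ∈ I, M.form (T s) (M.tension I γ s) = 0 := by
    intro s hs
    have h1 := hγ.form_tangent_deriv hM hU hs
    rw [hγ.deriv_tangent hM hU hs, map_sub, map_smul, smul_eq_mul, hM.symm _ (γ s)] at h1
    linarith [hTγ s hs]
  have hpos : ∀ s ∈ I, 0 < M.form (M.tension I γ s) (M.tension I γ s) := fun s hs =>
    hM.pos _ (hγ.mem s hs) _ (htγ s hs) (h0 s hs)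
  set k : ℝ → ℝ := fun s => M.len (M.tension I γ s) with hkdef
  have hk0 : ∀ s ∈ I, 0 < k s := fun s hs => Real.sqrt_pos.2 (hpos s hs)
  have hk2 : ∀ s ∈ I, k s ^ 2 = M.form (M.tension I γ s) (M.tension I γ s) := fun s hs =>
    Real.sq_sqrt (hpos s hs).le
  have hk : ContDiffOn ℝ ∞ k I := (contDiffOn_form M hten hten).sqrt fun s hs => (hpos s hs).ne'
  set N : ℝ → V := fun s => (k s)⁻¹ • M.tension I γ s with hNdef
  have hN : ContDiffOn ℝ ∞ N I := (hk.inv fun s hs => (hk0 s hs).ne').smul hten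
  have hkN : ∀ s ∈ I, M.tension I γ s = k s • N s := fun s hs => by
    rw [hNdef, smul_inv_smul₀ (hk0 s hs).ne']
  have hNγ : ∀ s ∈ I, M.curv * M.form (γ s) (N s) = 0 := fun s hs => by
    simp only [hNdef, map_smul, smul_eq_mul]
    linear_combination (k s)⁻¹ * htγ s hs
  have hTN : ∀ s ∈ I, M.form (T s) (N s) = 0 := fun s hs => by
    simp [hNdef, htT s hs]
  have hNN : ∀ s ∈ I, M.form (N s) (N s) = 1 := fun s hs => by
    have := (hk0 s hs).ne'
    simp only [hNdef, map_smul, smul_eq_mul, LinearMap.smul_apply, ← hk2 s hs]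
    field_simp
  set B : ℝ → V := fun s => cr (γ s, T s, N s) with hBdef
  have hB : ContDiffOn ℝ ∞ B I := hcr.comp_contDiffOn (hγ.smooth.prodMk (hT.prodMk hN))
  have hall := fun s (hs : s ∈ I) => hprop (γ s) (hγ.mem s hs) (T s) (N s) (hTγ s hs) (hNγ s hs)
    (hγ.unit_speed s hs) (hNN s hs) (hTN s hs)
  have hBγ : ∀ s ∈ I, M.curv * M.form (γ s) (B s) = 0 := fun s hs => (hall s hs).1
  have hBB : ∀ s ∈ I, M.form (B s) (B s) = 1 := fun s hs => (hall s hs).2.1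
  have hTB : ∀ s ∈ I, M.form (T s) (B s) = 0 := fun s hs => (hall s hs).2.2.1
  have hNB : ∀ s ∈ I, M.form (N s) (B s) = 0 := fun s hs => (hall s hs).2.2.2.1
  have htan : ∀ X : ℝ → V, (∀ s ∈ I, M.curv * M.form (γ s) (X s) = 0) → ∀ s ∈ I,
      M.tangentProj (γ s) (X s) = X s := fun X hX s hs => by
    rw [tangentProj, hM.symm, hX s hs, zero_smul, sub_zero]
  -- The difference of the two sides is tangent and orthogonal to T, N and B, hence zero by the last
  -- property of the vector product.
  have hcomplete : ∀ s ∈ I, ∀ d, M.curv * M.form (γ s) d = 0 → d = M.form (T s) d • T s +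
      M.form (N s) d • N s + M.form (B s) d • B s := by
    intro s hs d hd
    refine sub_eq_zero.1 ((hall s hs).2.2.2.2 _ ?_ ?_ ?_ ?_)
    · simp only [map_sub, map_add, map_smul, smul_eq_mul]
      linear_combination hd - M.form (T s) d * hTγ s hs - M.form (N s) d * hNγ s hs -
        M.form (B s) d * hBγ s hs
    · have : M.form (T s) (T s) = 1 := hγ.unit_speed s hs
      simp [this, hTN s hs, hTB s hs]
    · simp [hNN s hs, hM.symm (N s) (T s), hTN s hs, hNB s hs]
    · change M.form (B s) _ = 0
      simp [hBB s hs, hM.symm (B s) (T s), hTB s hs, hM.symm (B s) (N s), hNB s hs]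
  have hdT : ∀ s ∈ I, derivWithin T I s = k s • N s - M.curv • γ s := fun s hs => by
    rw [hγ.deriv_tangent hM hU hs, hkN s hs]
  have hdT' : ∀ s ∈ I, ∀ d, M.curv * M.form (γ s) d = 0 → M.form (derivWithin T I s) d =
      k s * M.form (N s) d := fun s hs d hd => by
    rw [hdT s hs, map_sub, map_smul, map_smul]
    simp [hd]
  have hprod : ∀ X Y : ℝ → V, ContDiffOn ℝ ∞ X I → ContDiffOn ℝ ∞ Y I → ∀ C,
      (∀ s ∈ I, M.form (X s) (Y s) = C) → ∀ s ∈ I,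
      M.form (X s) (derivWithin Y I s) + M.form (Y s) (derivWithin X I s) = 0 := by
    intro X Y hX hY C hC s hs
    have h := form_derivWithin_add (M := M) (c := 1) (C := C) hU hX hY
      (fun s hs => by rw [hC s hs, one_mul]) hs
    rw [hM.symm (Y s)]
    linarith
  have hcovtan : ∀ X : ℝ → V, ∀ s ∈ I, M.curv * M.form (γ s) (M.covDeriv I γ X s) = 0 :=
    fun X s hs => curv_mul_form_tangentProj hM (hγ.mem s hs) _
  have hcN : ∀ s ∈ I, M.covDeriv I γ N s = derivWithin N I s := fun s hs =>
    hγ.covDeriv_eq hM hU hN hNγ hs (hTN s hs)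
  have hcB : ∀ s ∈ I, M.covDeriv I γ B s = derivWithin B I s := fun s hs =>
    hγ.covDeriv_eq hM hU hB hBγ hs (hTB s hs)
  refine ⟨k, fun s => M.form (B s) (derivWithin N I s), N, B,
    ⟨hN, hB, htan N hNγ, htan B hBγ, hNN, hBB, hTN, hTB, hNB, hk0, hkN, fun s hs => ?_,
      fun s hs => ?_⟩⟩
  · have h := hcomplete s hs _ (hcovtan N s hs)
    have h1 := hprod T N hT hN 0 hTN s hs
    have h2 := hprod N N hN hN 1 hNN s hs
    rw [hM.symm (N s), hdT' s hs _ (hNγ s hs), hNN s hs] at h1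
    rw [hcN s hs] at h ⊢
    refine h.trans ?_
    rw [show M.form (T s) (derivWithin N I s) = -k s by linarith,
      show M.form (N s) (derivWithin N I s) = 0 by linarith, zero_smul, add_zero]
  · have h := hcomplete s hs _ (hcovtan B s hs)
    have h1 := hprod T B hT hB 0 hTB s hs
    have h2 := hprod N B hN hB 0 hNB s hs
    have h3 := hprod B B hB hB 1 hBB s hs
    rw [hM.symm (B s), hdT' s hs _ (hBγ s hs), hNB s hs] at h1
    rw [hcB s hs] at h ⊢
    refine h.trans ?_
    rw [show M.form (T s) (derivWithin B I s) = 0 by linarith,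
      show M.form (B s) (derivWithin B I s) = 0 by linarith,
      show M.form (N s) (derivWithin B I s) = -M.form (B s) (derivWithin N I s) by linarith,
      zero_smul, zero_smul, zero_add, add_zero]

theorem IsFrenetFrame.isProperHalfBiharmonic_iff (hF : M.IsFrenetFrame I γ k τ N B)
    (hγ : M.IsUnitSpeedCurve I γ) (hM : M.IsSpaceForm) (hU : UniqueDiffOn ℝ I) :
    M.IsProperHalfBiharmonic I γ ↔
      (∀ s ∈ interior I, eulerLagrangeN M.curv k τ s = 0 ∧ eulerLagrangeB k τ s = 0) ∧
        ∃ s ∈ I, ∃ t ∈ I, k s ≠ k t := by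
  have hne : (∃ s ∈ I, ∃ t ∈ I, M.len (M.tension I γ s) ≠ M.len (M.tension I γ t)) ↔
      ∃ s ∈ I, ∃ t ∈ I, k s ≠ k t := by
    refine exists_congr fun s => and_congr_right fun hs => exists_congr fun t =>
      and_congr_right fun ht => ?_
    rw [hF.len_tension hs, hF.len_tension ht]
  rw [← hne, ← hF.isPBiharmonic_iff hγ hM hU]
  refine ⟨fun h => ⟨h.biharmonic, h.nonconstant⟩, fun h => ⟨fun s hs h0 => ?_, h.1, h.2⟩⟩
  have h1 := hF.len_tension hs
  rw [h0] at h1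
  simp only [len, map_zero, Real.sqrt_zero] at h1
  exact (hF.k_pos s hs).ne h1

end SpaceFormModel

/-! ### Verification of the properties for the three models. -/

theorem contDiff_euclidean_coord {m : ℕ} (i : Fin m) {n : WithTop ℕ∞} :
    ContDiff ℝ n (fun x : EuclideanSpace ℝ (Fin m) => x i) :=
  (EuclideanSpace.proj (𝕜 := ℝ) i).contDiff

theorem euclidean3_form (x y : EuclideanSpace ℝ (Fin 3)) :
    euclidean3.form x y = x 0 * y 0 + x 1 * y 1 + x 2 * y 2 := by
  simp [euclidean3, PiLp.inner_apply, Fin.sum_univ_succ]; ring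

theorem sphere3_form (x y : EuclideanSpace ℝ (Fin 4)) :
    sphere3.form x y = x 0 * y 0 + x 1 * y 1 + x 2 * y 2 + x 3 * y 3 := by
  simp [sphere3, PiLp.inner_apply, Fin.sum_univ_succ]; ring

theorem hyperbolic3_form (x y : EuclideanSpace ℝ (Fin 4)) :
    hyperbolic3.form x y = -(x 0 * y 0) + x 1 * y 1 + x 2 * y 2 + x 3 * y 3 := rfl

theorem isSpaceForm_euclidean3 : euclidean3.IsSpaceForm where
  symm x y := by simp only [euclidean3_form]; ring
  curv_cases := Or.inl rfl
  curv_mem x _ := by simp [euclidean3]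
  normalize_mem x _ v _ _ := mem_univ _
  pos x _ v _ hv := by
    have h : euclidean3.form v v = inner ℝ v v := rfl
    rw [h]; exact real_inner_self_pos.2 hv
  exists_cross := by
    refine ⟨fun p => !₂[p.2.1 1 * p.2.2 2 - p.2.1 2 * p.2.2 1, p.2.1 2 * p.2.2 0 - p.2.1 0 * p.2.2 2,
      p.2.1 0 * p.2.2 1 - p.2.1 1 * p.2.2 0], ?_, ?_⟩
    · rw [contDiff_euclidean]
      have h1 : ∀ i, ContDiff ℝ ∞ (fun p : EuclideanSpace ℝ (Fin 3) × EuclideanSpace ℝ (Fin 3) ×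
          EuclideanSpace ℝ (Fin 3) => p.2.1 i) := fun i =>
        (contDiff_euclidean_coord i).comp (contDiff_fst.comp contDiff_snd)
      have h2 : ∀ i, ContDiff ℝ ∞ (fun p : EuclideanSpace ℝ (Fin 3) × EuclideanSpace ℝ (Fin 3) ×
          EuclideanSpace ℝ (Fin 3) => p.2.2 i) := fun i =>
        (contDiff_euclidean_coord i).comp (contDiff_snd.comp contDiff_snd)
      intro i
      fin_cases i
      · exact ((h1 1).mul (h2 2)).sub ((h1 2).mul (h2 1))
      · exact ((h1 2).mul (h2 0)).sub ((h1 0).mul (h2 2))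
      · exact ((h1 0).mul (h2 1)).sub ((h1 1).mul (h2 0))
    · intro x _ v w _ _ hv hw hvw
      simp only [euclidean3_form] at hv hw hvw
      simp only [euclidean3_form, Matrix.cons_val]
      have hnorm : (v 1 * w 2 - v 2 * w 1) * (v 1 * w 2 - v 2 * w 1) +
          (v 2 * w 0 - v 0 * w 2) * (v 2 * w 0 - v 0 * w 2) +
          (v 0 * w 1 - v 1 * w 0) * (v 0 * w 1 - v 1 * w 0) = 1 := by
        linear_combination (w 0 * w 0 + w 1 * w 1 + w 2 * w 2) * hv + hw -
          (v 0 * w 0 + v 1 * w 1 + v 2 * w 2) * hvw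
      refine ⟨by simp [euclidean3], hnorm, by ring, by ring, fun d _ hvd hwd hd => ?_⟩
      -- The determinant of v, w, v × w is |v × w|² = 1, so only d = 0 is orthogonal to all three.
      have hdet : Matrix.det !![v 0, v 1, v 2; w 0, w 1, w 2; v 1 * w 2 - v 2 * w 1,
          v 2 * w 0 - v 0 * w 2, v 0 * w 1 - v 1 * w 0] ≠ 0 := by
        rw [show Matrix.det _ = (1 : ℝ) by rw [← hnorm, Matrix.det_fin_three]; simp; ring]
        exact one_ne_zero
      have h0 := Matrix.eq_zero_of_mulVec_eq_zero hdet (v := ![d 0, d 1, d 2]) (by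
        ext i
        fin_cases i <;> simp [Matrix.mulVec, dotProduct, Fin.sum_univ_succ] <;> linarith)
      ext i
      fin_cases i
      · exact congrFun h0 0
      · exact congrFun h0 1
      · exact congrFun h0 2

/-- The Hodge star of `x ∧ v ∧ w` in Euclidean `ℝ⁴`. -/
noncomputable def tripleCross (p : EuclideanSpace ℝ (Fin 4) × EuclideanSpace ℝ (Fin 4) ×
    EuclideanSpace ℝ (Fin 4)) : EuclideanSpace ℝ (Fin 4) :=
  !₂[p.1 1 * (p.2.1 2 * p.2.2 3 - p.2.1 3 * p.2.2 2) - p.1 2 * (p.2.1 1 * p.2.2 3 - p.2.1 3 * p.2.2 1)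
      + p.1 3 * (p.2.1 1 * p.2.2 2 - p.2.1 2 * p.2.2 1),
    -(p.1 0 * (p.2.1 2 * p.2.2 3 - p.2.1 3 * p.2.2 2) - p.1 2 * (p.2.1 0 * p.2.2 3 - p.2.1 3 * p.2.2 0)
      + p.1 3 * (p.2.1 0 * p.2.2 2 - p.2.1 2 * p.2.2 0)),
    p.1 0 * (p.2.1 1 * p.2.2 3 - p.2.1 3 * p.2.2 1) - p.1 1 * (p.2.1 0 * p.2.2 3 - p.2.1 3 * p.2.2 0)
      + p.1 3 * (p.2.1 0 * p.2.2 1 - p.2.1 1 * p.2.2 0),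
    -(p.1 0 * (p.2.1 1 * p.2.2 2 - p.2.1 2 * p.2.2 1) - p.1 1 * (p.2.1 0 * p.2.2 2 - p.2.1 2 * p.2.2 0)
      + p.1 2 * (p.2.1 0 * p.2.2 1 - p.2.1 1 * p.2.2 0))]

theorem contDiff_tripleCross : ContDiff ℝ ∞ tripleCross := by
  rw [contDiff_euclidean]
  have h0 : ∀ i, ContDiff ℝ ∞ (fun p : EuclideanSpace ℝ (Fin 4) × EuclideanSpace ℝ (Fin 4) ×
      EuclideanSpace ℝ (Fin 4) => p.1 i) := fun i =>
    (contDiff_euclidean_coord i).comp contDiff_fst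
  have h1 : ∀ i, ContDiff ℝ ∞ (fun p : EuclideanSpace ℝ (Fin 4) × EuclideanSpace ℝ (Fin 4) ×
      EuclideanSpace ℝ (Fin 4) => p.2.1 i) := fun i =>
    (contDiff_euclidean_coord i).comp (contDiff_fst.comp contDiff_snd)
  have h2 : ∀ i, ContDiff ℝ ∞ (fun p : EuclideanSpace ℝ (Fin 4) × EuclideanSpace ℝ (Fin 4) ×
      EuclideanSpace ℝ (Fin 4) => p.2.2 i) := fun i =>
    (contDiff_euclidean_coord i).comp (contDiff_snd.comp contDiff_snd)
  have h : ∀ i a b c d, ContDiff ℝ ∞ (fun p : EuclideanSpace ℝ (Fin 4) × EuclideanSpace ℝ (Fin 4) ×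
      EuclideanSpace ℝ (Fin 4) => p.1 i * (p.2.1 a * p.2.2 b - p.2.1 c * p.2.2 d)) :=
    fun i a b c d => (h0 i).mul (((h1 a).mul (h2 b)).sub ((h1 c).mul (h2 d)))
  intro i
  fin_cases i
  · exact ((h 1 2 3 3 2).sub (h 2 1 3 3 1)).add (h 3 1 2 2 1)
  · exact (((h 0 2 3 3 2).sub (h 2 0 3 3 0)).add (h 3 0 2 2 0)).neg
  · exact ((h 0 1 3 3 1).sub (h 1 0 3 3 0)).add (h 3 0 1 1 0)
  · exact (((h 0 1 2 2 1).sub (h 1 0 2 2 0)).add (h 2 0 1 1 0)).neg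

section TripleCross

variable (x v w d : EuclideanSpace ℝ (Fin 4))

theorem dot_tripleCross : sphere3.form d (tripleCross (x, v, w)) =
    Matrix.det !![d 0, d 1, d 2, d 3; x 0, x 1, x 2, x 3; v 0, v 1, v 2, v 3; w 0, w 1, w 2, w 3] := by
  rw [sphere3_form, Matrix.det_succ_row_zero]
  simp [tripleCross, Fin.sum_univ_succ, Matrix.det_fin_three, Fin.succAbove, Matrix.submatrix]
  ring

end TripleCross

section TripleCross

variable (x v w d : EuclideanSpace ℝ (Fin 4))

/-- The right side is the Gram determinant of x, v, w; it is 1 on an orthonormal triple. -/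
theorem sphere3_form_tripleCross_self : sphere3.form (tripleCross (x, v, w)) (tripleCross (x, v, w)) =
    sphere3.form x x * (sphere3.form v v * sphere3.form w w - sphere3.form v w ^ 2) -
    sphere3.form x v * (sphere3.form x v * sphere3.form w w - sphere3.form v w * sphere3.form x w) +
    sphere3.form x w * (sphere3.form x v * sphere3.form v w - sphere3.form v v * sphere3.form x w) := by
  simp only [sphere3_form, tripleCross, Matrix.cons_val]
  ring

/-- Reflection in the time direction. -/
noncomputable def timeReflection (d : EuclideanSpace ℝ (Fin 4)) : EuclideanSpace ℝ (Fin 4) :=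
  !₂[-d 0, d 1, d 2, d 3]

theorem hyperbolic3_form_eq : hyperbolic3.form x d = sphere3.form x (timeReflection d) := by
  simp [hyperbolic3_form, sphere3_form, timeReflection]

theorem timeReflection_timeReflection : timeReflection (timeReflection d) = d := by
  ext i
  fin_cases i <;> simp [timeReflection]

theorem contDiff_timeReflection : ContDiff ℝ ∞ timeReflection := by
  rw [contDiff_euclidean]
  intro i
  fin_cases i
  · exact (contDiff_euclidean_coord 0).neg
  · exact contDiff_euclidean_coord 1
  · exact contDiff_euclidean_coord 2
  · exact contDiff_euclidean_coord 3

/-- The minus sign is the determinant of the Lorentz form. It offsets ⟨x,x⟩ = -1, so the product is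
again a unit vector. -/
theorem hyperbolic3_form_tripleCross_self :
    hyperbolic3.form (timeReflection (tripleCross (x, v, w)))
      (timeReflection (tripleCross (x, v, w))) =
    -(hyperbolic3.form x x * (hyperbolic3.form v v * hyperbolic3.form w w -
      hyperbolic3.form v w ^ 2) - hyperbolic3.form x v * (hyperbolic3.form x v *
      hyperbolic3.form w w - hyperbolic3.form v w * hyperbolic3.form x w) +
    hyperbolic3.form x w * (hyperbolic3.form x v * hyperbolic3.form v w -
      hyperbolic3.form v v * hyperbolic3.form x w)) := by
  simp only [hyperbolic3_form, tripleCross, timeReflection, Matrix.cons_val]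
  ring

variable {x v w d}

theorem dot_tripleCross_left : sphere3.form x (tripleCross (x, v, w)) = 0 := by
  simp only [sphere3_form, tripleCross, Matrix.cons_val]; ring

theorem dot_tripleCross_middle : sphere3.form v (tripleCross (x, v, w)) = 0 := by
  simp only [sphere3_form, tripleCross, Matrix.cons_val]; ring

theorem dot_tripleCross_right : sphere3.form w (tripleCross (x, v, w)) = 0 := by
  simp only [sphere3_form, tripleCross, Matrix.cons_val]; ring

/-- The hypothesis on c makes c, x, v, w a basis. The vector c is kept separate because in the
hyperbolic case it is the time-reflected product. -/
theorem eq_zero_of_dot_eq_zero {c : EuclideanSpace ℝ (Fin 4)}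
    (hc : sphere3.form c (tripleCross (x, v, w)) ≠ 0) (h0 : sphere3.form c d = 0)
    (h1 : sphere3.form x d = 0) (h2 : sphere3.form v d = 0) (h3 : sphere3.form w d = 0) :
    d = 0 := by
  rw [dot_tripleCross] at hc
  have h := Matrix.eq_zero_of_mulVec_eq_zero hc (v := ![d 0, d 1, d 2, d 3]) (by
    simp only [sphere3_form] at h0 h1 h2 h3
    ext i
    fin_cases i <;> simp [Matrix.mulVec, dotProduct, Fin.sum_univ_succ] <;> linarith)
  ext i
  fin_cases i
  · exact congrFun h 0
  · exact congrFun h 1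
  · exact congrFun h 2
  · exact congrFun h 3

end TripleCross

theorem isSpaceForm_sphere3 : sphere3.IsSpaceForm := by
  have hself : ∀ x, sphere3.form x x = ‖x‖ ^ 2 := fun x => real_inner_self_eq_norm_sq x
  have hone : ∀ r : ℝ, sphere3.curv * r = r := one_mul
  have hmem : ∀ x, x ∈ sphere3.carrier ↔ sphere3.form x x = 1 := fun x => by
    rw [hself, pow_eq_one_iff_of_nonneg (norm_nonneg x) two_ne_zero]
    exact mem_sphere_zero_iff_norm
  have hsymm : ∀ x y, sphere3.form x y = sphere3.form y x := fun x y => by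
    simp only [sphere3_form]; ring
  refine ⟨hsymm, Or.inr (Or.inl rfl), fun x hx => ?_, fun x hx v hxv hv => ?_, fun x _ v _ hv => ?_,
    tripleCross, contDiff_tripleCross, fun x hx v w hxv hxw hv hw hvw => ?_⟩
  · rw [(hmem x).1 hx, sq]; rfl
  · rw [hone] at hxv hv ⊢
    rw [hmem] at hx ⊢
    have h := Real.sq_sqrt hv.le
    have h0 := (Real.sqrt_pos.2 hv).ne'
    simp only [map_smul, map_add, LinearMap.smul_apply, LinearMap.add_apply, smul_eq_mul, hx, hxv,
      hsymm v x]
    field_simp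
    linarith
  · rw [hself]; positivity
  · rw [hone] at hxv hxw
    have hB := sphere3_form_tripleCross_self x v w
    rw [(hmem x).1 hx, hxv, hxw, hv, hw, hvw] at hB
    have hB' : sphere3.form (tripleCross (x, v, w)) (tripleCross (x, v, w)) = 1 := by
      rw [hB]; norm_num
    refine ⟨by rw [dot_tripleCross_left, mul_zero], hB', dot_tripleCross_middle,
      dot_tripleCross_right, fun d hxd hvd hwd hd => ?_⟩
    rw [hone] at hxd
    exact eq_zero_of_dot_eq_zero (by rw [hB']; exact one_ne_zero) hd hxd hvd hwd

theorem isSpaceForm_hyperbolic3 : hyperbolic3.IsSpaceForm := by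
  have hone : ∀ r : ℝ, hyperbolic3.curv * r = -r := fun r => neg_one_mul r
  have hmem : ∀ x, x ∈ hyperbolic3.carrier ↔ hyperbolic3.form x x = -1 ∧ 0 < x 0 := fun x => Iff.rfl
  have hsymm : ∀ x y, hyperbolic3.form x y = hyperbolic3.form y x := fun x y => by
    simp only [hyperbolic3_form]; ring
  have hCS : ∀ x v : EuclideanSpace ℝ (Fin 4), (x 1 * v 1 + x 2 * v 2 + x 3 * v 3) ^ 2 ≤
      (x 1 ^ 2 + x 2 ^ 2 + x 3 ^ 2) * (v 1 ^ 2 + v 2 ^ 2 + v 3 ^ 2) := fun x v => by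
    linarith [sq_nonneg (x 1 * v 2 - x 2 * v 1), sq_nonneg (x 1 * v 3 - x 3 * v 1),
      sq_nonneg (x 2 * v 3 - x 3 * v 2)]
  refine ⟨hsymm, Or.inr (Or.inr rfl), fun x hx => ?_, fun x hx v hxv hv => ?_,
    fun x hx v hxv hv => ?_, fun p => timeReflection (tripleCross p),
    contDiff_timeReflection.comp contDiff_tripleCross, fun x hx v w hxv hxw hv hw hvw => ?_⟩
  · rw [((hmem x).1 hx).1, sq]; rfl
  · rw [hone] at hxv hv ⊢
    rw [hmem] at hx ⊢
    obtain ⟨hx, hx0⟩ := hx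
    have hxv : hyperbolic3.form x v = 0 := neg_eq_zero.1 hxv
    have h := Real.sq_sqrt hv.le
    have h0 := Real.sqrt_pos.2 hv
    constructor
    · simp only [map_smul, map_add, LinearMap.smul_apply, LinearMap.add_apply, smul_eq_mul, hx, hxv,
        hsymm v x]
      field_simp
      linarith
    · refine mul_pos (inv_pos.2 h0) ?_
      have hz : hyperbolic3.form (x + v) (x + v) < 0 := by
        simp only [map_add, LinearMap.add_apply, hx, hxv, hsymm v x]
        linarith
      have hxz : hyperbolic3.form x (x + v) = -1 := by simp [hx, hxv]
      have hcs := hCS x (x + v)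
      generalize x + v = z at hz hxz hcs ⊢
      rw [hyperbolic3_form] at hx hz hxz
      -- If z₀ ≤ 0, Cauchy-Schwarz on the spatial parts gives (x₀z₀ - 1)² ≤ (x₀² - 1)z₀², that is 1
      -- + z₀² ≤ 2x₀z₀ ≤ 0. So the projection stays on the upper sheet.
      by_contra hle
      rw [not_lt] at hle
      have h1 : x 1 * z 1 + x 2 * z 2 + x 3 * z 3 = x 0 * z 0 - 1 := by linarith
      have h2 : x 1 ^ 2 + x 2 ^ 2 + x 3 ^ 2 = x 0 ^ 2 - 1 := by linarith
      have h3 : z 1 ^ 2 + z 2 ^ 2 + z 3 ^ 2 ≤ z 0 ^ 2 := by linarith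
      have h4 : x 0 * z 0 ≤ 0 := mul_nonpos_of_nonneg_of_nonpos hx0.le hle
      have h5 := mul_le_mul_of_nonneg_left h3
        (by positivity : 0 ≤ x 1 ^ 2 + x 2 ^ 2 + x 3 ^ 2)
      rw [h1] at hcs
      rw [h2] at hcs h5
      linarith [sq_nonneg (z 0)]
  · rw [hone, neg_eq_zero] at hxv
    obtain ⟨hx, hx0⟩ := (hmem x).1 hx
    have hcs := hCS x v
    rw [hyperbolic3_form] at hx hxv ⊢
    have h1 : x 1 * v 1 + x 2 * v 2 + x 3 * v 3 = x 0 * v 0 := by linarith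
    have h2 : x 1 ^ 2 + x 2 ^ 2 + x 3 ^ 2 = x 0 ^ 2 - 1 := by linarith
    rw [h1, h2] at hcs
    -- If v is not spacelike, its spatial square is at most v₀². With x₀²v₀² ≤ (x₀² - 1)(v₁² + v₂² +
    -- v₃²) this forces the spatial part to vanish, and then v₀ = 0 since x₀ > 0.
    by_contra hle
    rw [not_lt] at hle
    have h3 : v 1 ^ 2 + v 2 ^ 2 + v 3 ^ 2 ≤ v 0 ^ 2 := by linarith
    have h4 := mul_le_mul_of_nonneg_left h3 (sq_nonneg (x 0))
    have h5 : v 1 ^ 2 + v 2 ^ 2 + v 3 ^ 2 ≤ 0 := by linarith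
    have e1 : v 1 = 0 := by nlinarith [sq_nonneg (v 1), sq_nonneg (v 2), sq_nonneg (v 3)]
    have e2 : v 2 = 0 := by nlinarith [sq_nonneg (v 1), sq_nonneg (v 2), sq_nonneg (v 3)]
    have e3 : v 3 = 0 := by nlinarith [sq_nonneg (v 1), sq_nonneg (v 2), sq_nonneg (v 3)]
    have e0 : v 0 = 0 := by
      rw [e1, e2, e3] at h1
      exact (mul_eq_zero.1 (by linarith : x 0 * v 0 = 0)).resolve_left hx0.ne'
    exact hv (by ext i; fin_cases i <;> assumption)
  · rw [hone, neg_eq_zero] at hxv hxw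
    have hB := hyperbolic3_form_tripleCross_self x v w
    rw [((hmem x).1 hx).1, hxv, hxw, hv, hw, hvw] at hB
    have hB' : hyperbolic3.form (timeReflection (tripleCross (x, v, w)))
        (timeReflection (tripleCross (x, v, w))) = 1 := by rw [hB]; norm_num
    have hform : ∀ y, hyperbolic3.form y (timeReflection (tripleCross (x, v, w))) =
        sphere3.form y (tripleCross (x, v, w)) := fun y => by
      rw [hyperbolic3_form_eq, timeReflection_timeReflection]
    refine ⟨by rw [hform, dot_tripleCross_left, mul_zero], hB', by rw [hform, dot_tripleCross_middle],
      by rw [hform, dot_tripleCross_right], fun d hxd hvd hwd hd => ?_⟩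
    rw [hone, neg_eq_zero] at hxd
    simp only [hyperbolic3_form_eq _ d] at hxd hvd hwd hd
    have h0 := eq_zero_of_dot_eq_zero (by rw [← hform, hB']; exact one_ne_zero) hd hxd hvd hwd
    rw [← timeReflection_timeReflection d, h0]
    ext i
    fin_cases i <;> simp [timeReflection]

theorem mainTheorem2 (I : Set ℝ) (hI : I.OrdConnected) (hI' : (interior I).Nonempty) :
    (∀ γ : ℝ → EuclideanSpace ℝ (Fin 4), sphere3.IsUnitSpeedCurve I γ →
      (sphere3.IsProperHalfBiharmonic I γ →
        ∃ (k τ : ℝ → ℝ) (N B : ℝ → EuclideanSpace ℝ (Fin 4)),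
          sphere3.IsFrenetFrame I γ k τ N B) ∧
      ∀ (k τ : ℝ → ℝ) (N B : ℝ → EuclideanSpace ℝ (Fin 4)),
        sphere3.IsFrenetFrame I γ k τ N B →
        (sphere3.IsProperHalfBiharmonic I γ ↔
          ∃ b₁ b₂ b₃ : ℝ, 4 + 4 * b₁ ^ 2 < b₂ ^ 2 ∧ ∀ s ∈ I,
            k s = 2 / (b₂ + Real.sqrt (b₂ ^ 2 - 4 - 4 * b₁ ^ 2) * Real.sin (2 * (s + b₃))) ∧
            τ s = b₁ * k s)) ∧
    (∀ γ : ℝ → EuclideanSpace ℝ (Fin 3), euclidean3.IsUnitSpeedCurve I γ →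
      (euclidean3.IsProperHalfBiharmonic I γ →
        ∃ (k τ : ℝ → ℝ) (N B : ℝ → EuclideanSpace ℝ (Fin 3)),
          euclidean3.IsFrenetFrame I γ k τ N B) ∧
      ∀ (k τ : ℝ → ℝ) (N B : ℝ → EuclideanSpace ℝ (Fin 3)),
        euclidean3.IsFrenetFrame I γ k τ N B →
        (euclidean3.IsProperHalfBiharmonic I γ ↔
          ∃ b₁ b₄ b₅ : ℝ, ∀ s ∈ I,
            k s = b₄ / (b₄ ^ 2 * (s - b₅) ^ 2 + 1 + b₁ ^ 2) ∧
            τ s = b₁ * k s)) ∧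
    (∀ γ : ℝ → EuclideanSpace ℝ (Fin 4), hyperbolic3.IsUnitSpeedCurve I γ →
      (hyperbolic3.IsProperHalfBiharmonic I γ →
        ∃ (k τ : ℝ → ℝ) (N B : ℝ → EuclideanSpace ℝ (Fin 4)),
          hyperbolic3.IsFrenetFrame I γ k τ N B) ∧
      ∀ (k τ : ℝ → ℝ) (N B : ℝ → EuclideanSpace ℝ (Fin 4)),
        hyperbolic3.IsFrenetFrame I γ k τ N B →
        (hyperbolic3.IsProperHalfBiharmonic I γ ↔
          ∃ b₁ b₆ b₇ : ℝ, ∀ s ∈ I,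
            k s = 4 * Real.exp (-2 * (b₇ + s)) /
              ((b₆ + Real.exp (-2 * (b₇ + s))) ^ 2 + 4 + 4 * b₁ ^ 2) ∧
            τ s = b₁ * k s)) := by
  have hU := SpaceFormModel.uniqueDiffOn_of_ordConnected hI hI'
  refine ⟨fun γ hγ => ⟨fun h => hγ.exists_isFrenetFrame isSpaceForm_sphere3 hU h.tension_ne_zero,
    fun k τ N B hF => ?_⟩, fun γ hγ => ⟨fun h => hγ.exists_isFrenetFrame isSpaceForm_euclidean3 hU
    h.tension_ne_zero, fun k τ N B hF => ?_⟩, fun γ hγ => ⟨fun h => hγ.exists_isFrenetFrame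
    isSpaceForm_hyperbolic3 hU h.tension_ne_zero, fun k τ N B hF => ?_⟩⟩
  · exact (hF.isProperHalfBiharmonic_iff hγ isSpaceForm_sphere3 hU).trans
      (spherical_classification hI hI' (hF.smooth_k hγ isSpaceForm_sphere3 hU)
        (hF.smooth_τ hγ isSpaceForm_sphere3 hU) hF.k_pos)
  · exact (hF.isProperHalfBiharmonic_iff hγ isSpaceForm_euclidean3 hU).trans
      (flat_classification hI hI' (hF.smooth_k hγ isSpaceForm_euclidean3 hU)
        (hF.smooth_τ hγ isSpaceForm_euclidean3 hU) hF.k_pos)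
  · exact (hF.isProperHalfBiharmonic_iff hγ isSpaceForm_hyperbolic3 hU).trans
      (hyperbolic_classification hI hI' (hF.smooth_k hγ isSpaceForm_hyperbolic3 hU)
        (hF.smooth_τ hγ isSpaceForm_hyperbolic3 hU) hF.k_pos)
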